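/- Let $k$ be a field. For an $\mathbb N$-graded $k$-algebra $A$, let $\operatorname{Gr}A$ be the category of $\mathbb Z$-graded right $A$-modules with degree-preserving $A$-module homomorphisms, let $\operatorname{Fdim}A\subseteq\operatorname{Gr}A$ be the full subcategory of the modules that are the sum of their finite-dimensional submodules, and let $\operatorname{QGr}A$ be the quotient category $\operatorname{Gr}A/\operatorname{Fdim}A$, i.e. the localization of $\operatorname{Gr}A$ at the morphisms whose kernel and cokernel belong to $\operatorname{Fdim}A$. The shift $M\mapsto M(1)$, $M(1)_i=M_{i+1}$, on $\operatorname{Gr}A$ induces a functor on $\operatorname{QGr}A$, which is also denoted by $(1)$. A weighted path algebra $kQ$ is the path algebra of a finite quiver $Q$, with the grading induced by assigning to each arrow a degree $\ge 1$. Consider the following five classes of $\mathbb N$-graded $k$-algebras (taken up to isomorphism of graded algebras): - **PA1**: the path algebras of finite quivers, with all arrows in degree $1$; - **WPA**: the weighted path algebras of finite quivers; - **MA** (monomial algebras): the algebras $kQ/I$, where $kQ$ is a weighted path algebra of a finite quiver and $I$ is an ideal generated by a finite set of paths; - **CMA** (connected monomial algebras): the algebras $kQ/I$ as in **MA** for which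 $Q$ has exactly one vertex; - **CMA1**: the algebras in **CMA** that are generated as $k$-algebras by elements of degree $1$. **Theorem.** Let $\mathbf C$ and $\mathbf C'$ be any two of these five classes. For every algebra $A$ in $\mathbf C$ there are an algebra $A'$ in $\mathbf C'$ and an equivalence of categories $F:\operatorname{QGr}A\to\operatorname{QGr}A'$ such that $F(M(1))\cong F(M)(1)$, naturally in $M\in\operatorname{QGr}A$. -/

import Mathlib

open CategoryTheory

universe u

noncomputable section

namespace QuiverAlgebra

/-! ### Path algebras -/

/-- A finite quiver each of whose arrows has been assigned a degree `≥ 1`. -/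
structure WeightedQuiver where
  /-- the vertices -/
  V : Type
  [fintypeV : Fintype V]
  [quiver : Quiver.{0} V]
  [finiteArrows : ∀ v w : V, Finite (v ⟶ w)]
  /-- the degree of an arrow -/
  deg : ∀ {v w : V}, (v ⟶ w) → ℕ
  one_le_deg : ∀ {v w : V} (a : v ⟶ w), 1 ≤ deg a

attribute [instance] WeightedQuiver.fintypeV WeightedQuiver.quiver WeightedQuiver.finiteArrows

/-- The paths of a quiver, of any length `≥ 0` (those of length `0` being the trivial paths at the
vertices), each bundled with its source and its target. -/
abbrev PathOf (V : Type) [Quiver.{0} V] : Type := Σ v w : V, Quiver.Path v w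

/-- The degree of a path: the sum of the degrees of its arrows. -/
def WeightedQuiver.pathDeg (Q : WeightedQuiver) (p : PathOf Q.V) : ℕ :=
  p.2.2.addWeight (fun a => Q.deg a)

/-- The path algebra `kQ`: the `k`-vector space with basis the paths. -/
def PathAlgebra (k : Type u) [Field k] (V : Type) [Quiver.{0} V] : Type u :=
  PathOf V →₀ k

namespace PathAlgebra

variable {k : Type u} [Field k] {V : Type} [Quiver.{0} V]

instance : AddCommGroup (PathAlgebra k V) := inferInstanceAs (AddCommGroup (PathOf V →₀ k))
instance : Module k (PathAlgebra k V) := inferInstanceAs (Module k (PathOf V →₀ k))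

/-- The basis of the path algebra formed by the paths. -/
def basis : Module.Basis (PathOf V) k (PathAlgebra k V) :=
  Module.Basis.ofRepr (LinearEquiv.refl k (PathOf V →₀ k) :
    PathAlgebra k V ≃ₗ[k] (PathOf V →₀ k))

/-- The basis element of the path algebra given by a path. -/
def ofPath (p : PathOf V) : PathAlgebra k V := basis p

open Classical in
/-- The product of two paths: their concatenation (first `p`, then `q`) if `p` ends where `q`
starts, and zero otherwise. -/
def pathMul (p q : PathOf V) : PathAlgebra k V :=
  if h : p.2.1 = q.1 then ofPath ⟨p.1, q.2.1, p.2.2.comp (q.2.2.cast h.symm rfl)⟩ else 0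

/-- The bilinear extension of the product of paths. -/
def mulBilin : PathAlgebra k V →ₗ[k] PathAlgebra k V →ₗ[k] PathAlgebra k V :=
  basis.constr k fun p => basis.constr k fun q => pathMul p q

instance : Mul (PathAlgebra k V) := ⟨fun x y => mulBilin x y⟩

/-- The unit of the path algebra: the sum of all trivial paths. -/
instance [Fintype V] : One (PathAlgebra k V) :=
  ⟨∑ v : V, ofPath ⟨v, v, Quiver.Path.nil⟩⟩

theorem mul_def (x y : PathAlgebra k V) : x * y = mulBilin x y := rfl

theorem one_def [Fintype V] :
    (1 : PathAlgebra k V) = ∑ v : V, ofPath ⟨v, v, Quiver.Path.nil⟩ := rfl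

theorem ofPath_mul_ofPath (p q : PathOf V) :
    (ofPath p * ofPath q : PathAlgebra k V) = pathMul p q := by
  simp only [mul_def, mulBilin, ofPath, Module.Basis.constr_basis]

theorem ofPath_mul_of_eq {u v w : V} (p : Quiver.Path u v) (q : Quiver.Path v w) :
    (ofPath ⟨u, v, p⟩ * ofPath ⟨v, w, q⟩ : PathAlgebra k V) = ofPath ⟨u, w, p.comp q⟩ := by
  rw [ofPath_mul_ofPath]
  simp [pathMul]

theorem ofPath_mul_of_ne {p q : PathOf V} (h : p.2.1 ≠ q.1) :
    (ofPath p * ofPath q : PathAlgebra k V) = 0 := by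
  rw [ofPath_mul_ofPath]
  simp [pathMul, h]

theorem lhom_ext {M : Type*} [AddCommGroup M] [Module k M] {f g : PathAlgebra k V →ₗ[k] M}
    (h : ∀ p, f (ofPath p) = g (ofPath p)) : f = g :=
  basis.ext h

theorem ofPath_mul_assoc (p q r : PathOf V) :
    (ofPath p * ofPath q * ofPath r : PathAlgebra k V) = ofPath p * (ofPath q * ofPath r) := by
  obtain ⟨a, b, p⟩ := p
  obtain ⟨c, d, q⟩ := q
  obtain ⟨e, f, r⟩ := r
  have zero_mul' : ∀ x : PathAlgebra k V, 0 * x = 0 := fun x => by simp [mul_def]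
  have mul_zero' : ∀ x : PathAlgebra k V, x * 0 = 0 := fun x => by simp [mul_def]
  by_cases h1 : b = c
  · subst h1
    by_cases h2 : d = e
    · subst h2
      simp only [ofPath_mul_of_eq, Quiver.Path.comp_assoc]
    · rw [ofPath_mul_of_eq, ofPath_mul_of_ne (by exact h2),
        ofPath_mul_of_ne (p := ⟨b, d, q⟩) (q := ⟨e, f, r⟩) h2, mul_zero']
  · rw [ofPath_mul_of_ne (k := k) (p := ⟨a, b, p⟩) (q := ⟨c, d, q⟩) h1, zero_mul']
    by_cases h2 : d = e
    · subst h2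
      rw [ofPath_mul_of_eq, ofPath_mul_of_ne (by exact h1)]
    · rw [ofPath_mul_of_ne (k := k) (p := ⟨c, d, q⟩) (q := ⟨e, f, r⟩) h2, mul_zero']

theorem mul_assoc_aux (x y z : PathAlgebra k V) : x * y * z = x * (y * z) := by
  have h1 : ∀ p q : PathOf V, ofPath p * ofPath q * z = ofPath p * (ofPath q * z) := fun p q =>
    congrArg (fun f => f z) (lhom_ext (f := mulBilin (ofPath p * ofPath q))
      (g := (mulBilin (ofPath p)).comp (mulBilin (ofPath q))) fun r => ofPath_mul_assoc p q r)
  have h2 : ∀ p : PathOf V, ofPath p * y * z = ofPath p * (y * z) := fun p =>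
    congrArg (fun f => f y) (lhom_ext (f := (mulBilin.flip z).comp (mulBilin (ofPath p)))
      (g := (mulBilin (ofPath p)).comp (mulBilin.flip z)) fun q => h1 p q)
  exact congrArg (fun f => f x) (lhom_ext (f := (mulBilin.flip z).comp (mulBilin.flip y))
      (g := mulBilin.flip (y * z)) fun p => h2 p)

theorem one_mul_aux [Fintype V] (x : PathAlgebra k V) : 1 * x = x := by
  have h : mulBilin (1 : PathAlgebra k V) = LinearMap.id := by
    refine lhom_ext fun p => ?_
    obtain ⟨a, b, p⟩ := p
    rw [one_def, map_sum, LinearMap.sum_apply, Finset.sum_eq_single a]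
    · rw [← mul_def, ofPath_mul_of_eq, Quiver.Path.nil_comp]; rfl
    · intro v _ hv
      rw [← mul_def, ofPath_mul_of_ne (by exact hv)]
    · intro h; exact absurd (Finset.mem_univ a) h
  exact congrArg (fun f => f x) h

theorem mul_one_aux [Fintype V] (x : PathAlgebra k V) : x * 1 = x := by
  have h : mulBilin.flip (1 : PathAlgebra k V) = LinearMap.id := by
    refine lhom_ext fun p => ?_
    obtain ⟨a, b, p⟩ := p
    rw [one_def, map_sum, LinearMap.sum_apply, Finset.sum_eq_single b]
    · rw [LinearMap.flip_apply, ← mul_def, ofPath_mul_of_eq, Quiver.Path.comp_nil]; rfl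
    · intro v _ hv
      rw [LinearMap.flip_apply, ← mul_def, ofPath_mul_of_ne (by exact hv.symm)]
    · intro h; exact absurd (Finset.mem_univ b) h
  exact congrArg (fun f => f x) h

instance [Fintype V] : Ring (PathAlgebra k V) :=
  { (inferInstance : AddCommGroup (PathAlgebra k V)) with
    mul := (· * ·)
    one := 1
    mul_assoc := mul_assoc_aux
    one_mul := one_mul_aux
    mul_one := mul_one_aux
    left_distrib := fun x y z => by simp [mul_def]
    right_distrib := fun x y z => by simp [mul_def]
    zero_mul := fun x => by simp [mul_def]
    mul_zero := fun x => by simp [mul_def] }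

instance [Fintype V] : Algebra k (PathAlgebra k V) :=
  Algebra.ofModule (fun r x y => by simp [mul_def]) (fun r x y => by simp [mul_def])

end PathAlgebra

/-- The degree `n` part of the path algebra of a weighted quiver: the span of the paths of
degree `n`. -/
def PathAlgebra.grading (k : Type u) [Field k] (Q : WeightedQuiver) (n : ℕ) :
    Submodule k (PathAlgebra k Q.V) :=
  Submodule.span k (PathAlgebra.ofPath '' {p | Q.pathDeg p = n})

/-! ### Monomial algebras -/

/-- The two-sided ideal of `kQ` generated by a set of paths. -/
def monomialIdeal (k : Type u) [Field k] (Q : WeightedQuiver) (S : Set (PathOf Q.V)) :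
    TwoSidedIdeal (PathAlgebra k Q.V) :=
  TwoSidedIdeal.span (PathAlgebra.ofPath '' S)

/-- The algebra `kQ/I`, where `I` is the ideal generated by a set of paths. -/
abbrev MonomialAlgebra (k : Type u) [Field k] (Q : WeightedQuiver) (S : Set (PathOf Q.V)) :
    Type u :=
  (monomialIdeal k Q S).ringCon.Quotient

/-- The grading on `kQ/I` induced by that on `kQ`. -/
def MonomialAlgebra.grading (k : Type u) [Field k] (Q : WeightedQuiver) (S : Set (PathOf Q.V))
    (n : ℕ) : Submodule k (MonomialAlgebra k Q S) :=
  (PathAlgebra.grading k Q n).map ((monomialIdeal k Q S).ringCon.mkₐ k).toLinearMap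

/-! ### The five classes of graded algebras -/

/-- An `ℕ`-graded `k`-algebra (associative and unital, not necessarily commutative). -/
structure GradedAlg (k : Type u) [Field k] where
  /-- the underlying algebra -/
  carrier : Type u
  [ring : Ring carrier]
  [algebra : Algebra k carrier]
  /-- the homogeneous components -/
  grading : ℕ → Submodule k carrier
  [gradedAlgebra : GradedAlgebra grading]

attribute [instance] GradedAlg.ring GradedAlg.algebra GradedAlg.gradedAlgebra

variable {k : Type u} [Field k]

/-- `A` is isomorphic, as a graded algebra, to the weighted path algebra `kQ`. -/
def GradedAlg.IsPathAlgebraOf (A : GradedAlg k) (Q : WeightedQuiver) : Prop :=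
  ∃ e : PathAlgebra k Q.V ≃ₐ[k] A.carrier,
    ∀ n, (PathAlgebra.grading k Q n).map e.toLinearMap = A.grading n

/-- `A` is isomorphic, as a graded algebra, to `kQ/I`, where `I` is generated by the set of
paths `S`. -/
def GradedAlg.IsMonomialAlgebraOf (A : GradedAlg k) (Q : WeightedQuiver)
    (S : Set (PathOf Q.V)) : Prop :=
  ∃ e : MonomialAlgebra k Q S ≃ₐ[k] A.carrier,
    ∀ n, (MonomialAlgebra.grading k Q S n).map e.toLinearMap = A.grading n

/-- The names of the five classes. -/
inductive AlgClass where
  | PA1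
  | WPA
  | MA
  | CMA
  | CMA1

/-- Membership of a graded algebra in one of the five classes:
* `PA1`: path algebras of finite quivers with all arrows in degree `1`;
* `WPA`: weighted path algebras of finite quivers;
* `MA`: quotients of weighted path algebras of finite quivers by an ideal generated by a finite
  set of paths;
* `CMA`: the algebras as in `MA` for which the quiver has exactly one vertex;
* `CMA1`: the algebras in `CMA` that are generated by elements of degree `1`. -/
def AlgClass.Mem (A : GradedAlg k) : AlgClass → Prop
  | .PA1 => ∃ Q : WeightedQuiver,
      (∀ (v w : Q.V) (a : v ⟶ w), Q.deg a = 1) ∧ A.IsPathAlgebraOf Q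
  | .WPA => ∃ Q : WeightedQuiver, A.IsPathAlgebraOf Q
  | .MA => ∃ (Q : WeightedQuiver) (S : Set (PathOf Q.V)), S.Finite ∧ A.IsMonomialAlgebraOf Q S
  | .CMA => ∃ (Q : WeightedQuiver) (S : Set (PathOf Q.V)),
      Nat.card Q.V = 1 ∧ S.Finite ∧ A.IsMonomialAlgebraOf Q S
  | .CMA1 => (∃ (Q : WeightedQuiver) (S : Set (PathOf Q.V)),
      Nat.card Q.V = 1 ∧ S.Finite ∧ A.IsMonomialAlgebraOf Q S) ∧
      Algebra.adjoin k (A.grading 1 : Set A.carrier) = ⊤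

/-! ### Graded right modules -/

/-- The `ℤ`-graded right modules over an `ℕ`-graded algebra `A`; a right `A`-module is a module
over the opposite algebra. -/
structure GrMod (A : GradedAlg k) where
  /-- the underlying right module -/
  carrier : Type u
  [addCommGroup : AddCommGroup carrier]
  [moduleBase : Module k carrier]
  [module : Module A.carrierᵐᵒᵖ carrier]
  [isScalarTower : IsScalarTower k A.carrierᵐᵒᵖ carrier]
  /-- the homogeneous components -/
  grading : ℤ → Submodule k carrier
  isInternal : DirectSum.IsInternal grading
  smul_mem : ∀ {i : ℤ} {n : ℕ} {m : carrier} {a : A.carrier},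
    m ∈ grading i → a ∈ A.grading n → MulOpposite.op a • m ∈ grading (i + n)

attribute [instance] GrMod.addCommGroup GrMod.moduleBase GrMod.module GrMod.isScalarTower

namespace GrMod

variable {A : GradedAlg k}

/-- The degree-preserving homomorphisms of graded right modules. -/
@[ext]
structure Hom (M N : GrMod A) where
  /-- the underlying homomorphism of right modules -/
  toLin : M.carrier →ₗ[A.carrierᵐᵒᵖ] N.carrier
  map_mem : ∀ {i : ℤ} {m : M.carrier}, m ∈ M.grading i → toLin m ∈ N.grading i

/-- `Gr A`, the category of `ℤ`-graded right `A`-modules. -/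
instance : Category (GrMod A) where
  Hom M N := Hom M N
  id M := ⟨LinearMap.id, fun h => h⟩
  comp f g := ⟨g.toLin.comp f.toLin, fun h => g.map_mem (f.map_mem h)⟩

/-- The shift `M(1)` of a graded module: the same module, graded by `M(1)_i = M_{i+1}`. -/
def shiftObj (M : GrMod A) : GrMod A where
  carrier := M.carrier
  grading i := M.grading (i + 1)
  isInternal := by
    rw [DirectSum.isInternal_submodule_iff_iSupIndep_and_iSup_eq_top]
    obtain ⟨h1, h2⟩ :=
      (DirectSum.isInternal_submodule_iff_iSupIndep_and_iSup_eq_top _).mp M.isInternal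
    refine ⟨h1.comp (add_left_injective 1), ?_⟩
    rw [← h2]
    exact (Equiv.addRight (1 : ℤ)).surjective.iSup_comp M.grading
  smul_mem := by
    intro i n m a hm ha
    have h := M.smul_mem hm ha
    rwa [add_right_comm] at h

/-- The shift functor `(1)` on `Gr A`. -/
def shift (A : GradedAlg k) : GrMod A ⥤ GrMod A where
  obj := shiftObj
  map f := ⟨f.toLin, fun h => f.map_mem h⟩

end GrMod

/-! ### The quotient category -/

/-- The condition defining `Fdim A`: the module `M` is the sum of its finite-dimensional
submodules. (For a graded module the graded submodules suffice, since a homogeneous element that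
lies in a finite-dimensional submodule generates a graded finite-dimensional submodule.) -/
def IsSumOfFinDim (A : GradedAlg k) (M : Type u) [AddCommGroup M] [Module k M]
    [Module A.carrierᵐᵒᵖ M] [IsScalarTower k A.carrierᵐᵒᵖ M] : Prop :=
  sSup {N : Submodule A.carrierᵐᵒᵖ M | Module.Finite k N} = ⊤

/-- The morphisms of `Gr A` whose kernel and cokernel belong to `Fdim A`. -/
def isoModFdim (A : GradedAlg k) : MorphismProperty (GrMod A) := fun _ N f =>
  IsSumOfFinDim A (LinearMap.ker f.toLin) ∧
    IsSumOfFinDim A (N.carrier ⧸ LinearMap.range f.toLin)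

/-- `QGr A`, the quotient of the abelian category `Gr A` by the Serre subcategory `Fdim A`, that
is, the localization of `Gr A` at the morphisms whose kernel and cokernel belong to `Fdim A`. -/
def QGr (A : GradedAlg k) := (isoModFdim A).Localization

instance (A : GradedAlg k) : Category (QGr A) :=
  inferInstanceAs (Category (isoModFdim A).Localization)

/-- The quotient functor `Gr A ⥤ QGr A`. -/
def QGr.π (A : GradedAlg k) : GrMod A ⥤ QGr A := (isoModFdim A).Q

theorem QGr.shift_inverts (A : GradedAlg k) :
    (isoModFdim A).IsInvertedBy (GrMod.shift A ⋙ QGr.π A) := fun _ _ f hf =>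
  (isoModFdim A).Q_inverts ((GrMod.shift A).map f) hf

/-- The functor `(1)` on `QGr A` induced by the shift functor on `Gr A`. -/
def QGr.shift (A : GradedAlg k) : QGr A ⥤ QGr A :=
  Localization.Construction.lift (GrMod.shift A ⋙ QGr.π A) (QGr.shift_inverts A)

end QuiverAlgebra

end

/-! All five classes consist of monomial algebras, and `QGr` with its shift only sees what happens
in large degrees, up to a non-unital form of Morita equivalence. It therefore suffices to connect
every monomial algebra to a path algebra with arrows in degree 1, and every such path algebra to a
connected monomial algebra generated in degree 1.

The tool is a degree-preserving homomorphism `f : A → B` that may send 1 to an idempotent `e ≠ 1`.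
Restriction `N ↦ N e` and coinduction `M ↦ Hom_A(B e, M)` (graded Hom) come with a unit and a
counit, and they induce inverse equivalences of quotient categories under the conditions
`GrNUHom.IsTailEquiv`. The algebras must be locally finite, so that torsion means that each element
is killed by all sufficiently large degrees. For `a` homogeneous of degree at least `m`, the map `b
↦ f(a) b e` must lift through `f` to a right `A`-linear map `L : B → A` with `L(1) = a`. Finally,
for a fixed finite set of elements `q` and every `n`, the elements of `B` of large degree must be
sums of products `q f(a) f(a') c` with `deg a ≥ n` and `deg a' ≥ m`. Such a product acts on an
element `φ` of the coinduction by `x ↦ φ(q) a L(c x)` (`coindVal_factor`), which reduces questions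
about coinduction to the finitely many values `φ(q)`.

Two homomorphisms of this kind are used. For `A = kQ/I`, take the algebra generated by the arrows as
free letters, modulo the short words whose product is zero in `A`. Its map to `A` is unital and
bijective in positive degrees, since only the vertex idempotents are missed
(`exists_qGrEquiv_wordAlg`).

For a connected monomial algebra whose forbidden words have length at most `L + 1`, take the graph
whose vertices record the last `L` letters and the number of unit steps left in the current letter
(`WordData.graph`). A letter of weight `d` becomes a path of `d` arrows of degree 1. A word is sent
to the sum of the paths reading it from all possible states, and 1 to the sum of the idempotents of
the states at which no letter is in progress. This map need not be injective even in large degrees,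
because a word with no allowed left extension is killed. The lifts `L` still exist: a word of length
at least `L` determines the state in which its reading ends, so it can be continued along any path
from there (`WordData.continueMap`).

A path algebra with arrows in degree 1 is itself monomial, with no relations; applying the first
construction to it gives an algebra generated in degree 1. -/

noncomputable section

namespace QuiverAlgebra

open scoped RightActions

/-! ### Gradings -/

section Gradings

variable {k : Type*} [Field k] {M : Type*} [AddCommGroup M] [Module k M]
  {ι : Type*}

/-- A family of submodules spanning the module is a grading as soon as every member of the family
is separated from zero by linear maps that vanish on all the other members. -/
theorem isInternal_of_separated [DecidableEq ι] (𝓜 : ι → Submodule k M) (hsup : ⨆ i, 𝓜 i = ⊤)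
    {N : Type*} [AddCommGroup N] [Module k N]
    (h : ∀ i, ∀ x ∈ 𝓜 i, x ≠ 0 → ∃ φ : M →ₗ[k] N, (∀ j, j ≠ i → 𝓜 j ≤ LinearMap.ker φ) ∧ φ x ≠ 0) :
    DirectSum.IsInternal 𝓜 := by
  rw [DirectSum.isInternal_submodule_iff_iSupIndep_and_iSup_eq_top]
  refine ⟨fun i => ?_, hsup⟩
  rw [Submodule.disjoint_def]
  intro x hx hx'
  by_contra hne
  obtain ⟨φ, h1, h2⟩ := h i x hx hne
  exact h2 ((iSup₂_le h1 : (⨆ j, ⨆ (_ : j ≠ i), 𝓜 j) ≤ LinearMap.ker φ) hx')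

theorem iSup_comap_subtype_eq_top (p : ι → Submodule k M) (q : Submodule k M)
    (h : q = ⨆ i, p i) : ⨆ i, (p i).comap q.subtype = ⊤ := by
  apply Submodule.map_injective_of_injective q.injective_subtype
  rw [Submodule.map_iSup, Submodule.map_top, Submodule.range_subtype]
  have : ∀ i, Submodule.map q.subtype ((p i).comap q.subtype) = p i := fun i => by
    rw [Submodule.map_comap_subtype, inf_eq_right, h]
    exact le_iSup p i
  simp only [this, h]

end Gradings

variable {k : Type u} [Field k]

/-! ### Homogeneous components in graded modules -/

namespace GrMod

variable {A : GradedAlg k} (M : GrMod A)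

/-- The projection of a graded module onto its component of degree `i`. -/
def proj (i : ℤ) : M.carrier →ₗ[k] M.carrier :=
  (M.grading i).subtype ∘ₗ DirectSum.component k ℤ (fun i => M.grading i) i ∘ₗ
    (LinearEquiv.ofBijective (DirectSum.coeLinearMap M.grading) M.isInternal).symm.toLinearMap

variable {M}

theorem proj_mem (i : ℤ) (x : M.carrier) : M.proj i x ∈ M.grading i := by
  simp [proj]

theorem proj_of_mem {i : ℤ} {x : M.carrier} (hx : x ∈ M.grading i) : M.proj i x = x :=
  congrArg Subtype.val (M.isInternal.ofBijective_coeLinearMap_of_mem hx)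

theorem proj_of_mem_of_ne {i j : ℤ} (hij : i ≠ j) {x : M.carrier} (hx : x ∈ M.grading j) :
    M.proj i x = 0 :=
  congrArg Subtype.val (M.isInternal.ofBijective_coeLinearMap_of_mem_ne hij.symm hx)

theorem iSup_grading {M : GrMod A} : ⨆ i, M.grading i = ⊤ := M.isInternal.submodule_iSup_eq_top

@[elab_as_elim]
theorem induction_homogeneous {p : M.carrier → Prop} (x : M.carrier)
    (mem : ∀ i, ∀ x ∈ M.grading i, p x) (zero : p 0) (add : ∀ x y, p x → p y → p (x + y)) :
    p x :=
  Submodule.iSup_induction M.grading (motive := p) (by rw [iSup_grading]; trivial)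
    mem zero add

theorem smul_k_smul (c : k) (x : M.carrier) (a : A.carrier) : (c • x) <• a = c • (x <• a) :=
  smul_comm _ _ _

/-- Right multiplication by `a`, as a `k`-linear map. -/
def mulRight (M : GrMod A) (a : A.carrier) : M.carrier →ₗ[k] M.carrier where
  toFun x := x <• a
  map_add' := by simp
  map_smul' := by intro c x; exact smul_k_smul c x a

theorem exists_finset_proj (x : M.carrier) : ∃ s : Finset ℤ, (∀ j ∉ s, M.proj j x = 0) ∧
    ∑ j ∈ s, M.proj j x = x := by
  classical
  suffices H : ∃ s : Finset ℤ, ∀ t, s ⊆ t → (∀ j ∉ t, M.proj j x = 0) ∧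
      ∑ j ∈ t, M.proj j x = x from
    let ⟨s, hs⟩ := H; ⟨s, hs s subset_rfl⟩
  induction x using induction_homogeneous with
  | mem i x hx =>
    refine ⟨{i}, fun t ht => ⟨fun j hj => proj_of_mem_of_ne ?_ hx, ?_⟩⟩
    · rintro rfl; exact hj (ht (by simp))
    · rw [Finset.sum_eq_single i, proj_of_mem hx]
      · intro j _ hj; exact proj_of_mem_of_ne hj hx
      · intro h; exact absurd (ht (by simp)) h
  | zero => exact ⟨∅, fun t _ => by simp⟩
  | add x y hx hy =>
    obtain ⟨s, hs⟩ := hx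
    obtain ⟨t, ht⟩ := hy
    refine ⟨s ∪ t, fun u hu => ?_⟩
    obtain ⟨h1, h2⟩ := hs u (Finset.union_subset_left hu)
    obtain ⟨h3, h4⟩ := ht u (Finset.union_subset_right hu)
    exact ⟨fun j hj => by rw [map_add, h1 j hj, h3 j hj, add_zero],
      by simp only [map_add, Finset.sum_add_distrib, h2, h4]⟩

theorem proj_smul {n : ℕ} {a : A.carrier} (ha : a ∈ A.grading n) (x : M.carrier) (j : ℤ) :
    M.proj j (x <• a) = M.proj (j - n) x <• a := by
  induction x using induction_homogeneous with
  | mem i x hx =>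
    by_cases h : j - n = i
    · have h' : j = i + n := by omega
      rw [h, proj_of_mem hx, h', proj_of_mem (M.smul_mem hx ha)]
    · rw [proj_of_mem_of_ne h hx, smul_zero, proj_of_mem_of_ne _ (M.smul_mem hx ha)]
      omega
  | zero => simp
  | add x y hx hy => simp only [smul_add, map_add, hx, hy]

theorem Hom.map_proj {N : GrMod A} (f : M ⟶ N) (x : M.carrier) (j : ℤ) :
    N.proj j (f.toLin x) = f.toLin (M.proj j x) := by
  induction x using induction_homogeneous with
  | mem i x hx =>
    by_cases h : j = i
    · subst h
      rw [proj_of_mem hx, proj_of_mem (f.map_mem hx)]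
    · rw [proj_of_mem_of_ne h hx, map_zero, proj_of_mem_of_ne h (f.map_mem hx)]
  | zero => simp
  | add x y hx hy => simp only [map_add, hx, hy]

/-- The `k`-linear map underlying a homomorphism of graded modules. -/
def Hom.toLinK {N : GrMod A} (f : M ⟶ N) : M.carrier →ₗ[k] N.carrier :=
  f.toLin.restrictScalars k

theorem Hom.map_smul' {N : GrMod A} (f : M ⟶ N) (x : M.carrier) (a : A.carrier) :
    f.toLin (x <• a) = f.toLin x <• a := f.toLin.map_smul _ _
/-- An element whose orbit is finite-dimensional modulo a homogeneous submodule is moved into that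
submodule by all homogeneous algebra elements of sufficiently large degree. -/
theorem exists_smul_mem_of_finite (R : Submodule k M.carrier)
    (hR : ∀ x ∈ R, ∀ j, M.proj j x ∈ R) (y : M.carrier) (t : Finset M.carrier)
    (ht : ∀ a : A.carrier, y <• a ∈ Submodule.span k (t : Set M.carrier) ⊔ R) :
    ∃ n₀ : ℕ, ∀ n ≥ n₀, ∀ a ∈ A.grading n, y <• a ∈ R := by
  classical
  choose s hs hs' using fun x : M.carrier => exists_finset_proj x
  -- The finite set `t` involves only finitely many degrees; in any other degree the component of `y
  -- <• a` comes from `R` alone.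
  have key : ∀ a : A.carrier, ∀ j ∉ t.biUnion s, M.proj j (y <• a) ∈ R := by
    intro a j hj
    obtain ⟨z, hz, r, hr, hzr⟩ := Submodule.mem_sup.mp (ht a)
    have : M.proj j z = 0 := by
      have : Submodule.span k (t : Set M.carrier) ≤ LinearMap.ker (M.proj j) := by
        rw [Submodule.span_le]
        intro x hx
        exact hs x j fun h => hj (Finset.mem_biUnion.mpr ⟨x, hx, h⟩)
      exact this hz
    rw [← hzr, map_add, this, zero_add]
    exact hR r hr j
  obtain ⟨b, hb⟩ := (t.biUnion s).bddAbove
  obtain ⟨c, hc⟩ := (s y).bddBelow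
  -- Here `b` bounds from above the degrees occurring in `t`, and `c` bounds from below those
  -- occurring in `y`. An element of degree greater than `b - c` moves every component of `y` beyond
  -- `b`.
  refine ⟨(b - c + 1).toNat, fun n hn a ha => ?_⟩
  rw [← hs' (y <• a)]
  refine Submodule.sum_mem _ fun j _ => ?_
  by_cases hj : j ∈ t.biUnion s
  · rw [proj_smul ha, hs y, smul_zero]
    · exact R.zero_mem
    · intro h
      have h1 := hb hj
      have h2 := hc h
      omega
  · exact key a j hj

end GrMod

/-! ### Torsion modules over a locally finite algebra -/

/-- A graded algebra whose homogeneous components are finite-dimensional. -/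
def GradedAlg.LocallyFinite (A : GradedAlg k) : Prop := ∀ n, Module.Finite k (A.grading n)

theorem GradedAlg.exists_finset_span (A : GradedAlg k) (hA : A.LocallyFinite) (n : ℕ) :
    ∃ t : Finset A.carrier, ∀ i < n, A.grading i ≤ Submodule.span k (t : Set A.carrier) := by
  classical
  have : ∀ i, ∃ t : Finset A.carrier, Submodule.span k (t : Set A.carrier) = A.grading i :=
    fun i => Module.Finite.iff_fg.mp (hA i)
  choose t ht using this
  refine ⟨(Finset.range n).biUnion t, fun i hi => ?_⟩
  rw [← ht i]
  exact Submodule.span_mono (by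
    intro x hx
    exact Finset.mem_coe.mpr (Finset.mem_biUnion.mpr ⟨i, by simpa using hi, hx⟩))

@[elab_as_elim]
theorem GradedAlg.induction_homogeneous {A : GradedAlg k} {p : A.carrier → Prop} (x : A.carrier)
    (mem : ∀ i, ∀ x ∈ A.grading i, p x) (zero : p 0) (add : ∀ x y, p x → p y → p (x + y)) :
    p x :=
  Submodule.iSup_induction A.grading (motive := p)
    ((DirectSum.Decomposition.isInternal A.grading).submodule_iSup_eq_top ▸ Submodule.mem_top :
      x ∈ _) mem zero add

/-- Only the components of `A` of degree less than `n₀` contribute to the cyclic submodule generated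
by `x`. There are finitely many of them, each finite-dimensional, so every cyclic submodule is
finite-dimensional. -/
theorem isSumOfFinDim_of_smul_eq_zero (A : GradedAlg k) (hA : A.LocallyFinite)
    (X : Type u) [AddCommGroup X] [Module k X] [Module A.carrierᵐᵒᵖ X]
    [IsScalarTower k A.carrierᵐᵒᵖ X]
    (h : ∀ x : X, ∃ n₀ : ℕ, ∀ n ≥ n₀, ∀ a ∈ A.grading n, x <• a = 0) : IsSumOfFinDim A X := by
  rw [IsSumOfFinDim, eq_top_iff]
  intro x _
  refine (le_sSup (a := Submodule.span A.carrierᵐᵒᵖ {x}) ?_) (Submodule.mem_span_singleton_self x)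
  obtain ⟨n₀, hn⟩ := h x
  obtain ⟨t, ht⟩ := A.exists_finset_span hA n₀
  let φ : A.carrier →ₗ[k] X :=
    { toFun := fun a => x <• a
      map_add' := fun a b => by rw [MulOpposite.op_add, add_smul]
      map_smul' := fun c a => by rw [MulOpposite.op_smul, smul_assoc, RingHom.id_apply] }
  have hφ : ∀ a, φ a ∈ Submodule.span k (φ '' t) := by
    intro a
    induction a using GradedAlg.induction_homogeneous with
    | mem i a ha =>
      by_cases hi : i < n₀
      · rw [Submodule.span_image]
        exact Submodule.mem_map_of_mem (ht i hi ha)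
      · rw [show φ a = 0 from hn i (not_lt.mp hi) a ha]
        exact Submodule.zero_mem _
    | zero => simp
    | add a b ha hb => rw [map_add]; exact Submodule.add_mem _ ha hb
  have hle : (Submodule.span A.carrierᵐᵒᵖ {x}).restrictScalars k ≤ Submodule.span k (φ '' t) := by
    intro y hy
    obtain ⟨a, rfl⟩ := Submodule.mem_span_singleton.mp hy
    exact hφ a.unop
  have : Module.Finite k (Submodule.span k (φ '' (t : Set A.carrier))) :=
    Module.Finite.span_of_finite k (t.finite_toSet.image φ)
  exact Module.Finite.of_injective (Submodule.inclusion hle) (Submodule.inclusion_injective hle)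

/-- The finite-dimensional submodules form a directed family, because the sum of two of them is
again finite-dimensional; hence their supremum is their union. -/
theorem exists_finite_mem_of_isSumOfFinDim {A : GradedAlg k} {X : Type u} [AddCommGroup X]
    [Module k X] [Module A.carrierᵐᵒᵖ X] [IsScalarTower k A.carrierᵐᵒᵖ X]
    (h : IsSumOfFinDim A X) (x : X) :
    ∃ N : Submodule A.carrierᵐᵒᵖ X, Module.Finite k N ∧ x ∈ N := by
  have hx : x ∈ sSup {N : Submodule A.carrierᵐᵒᵖ X | Module.Finite k N} := by
    rw [IsSumOfFinDim] at h; rw [h]; trivial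
  refine (Submodule.mem_sSup_of_directed ⟨⊥, ?_⟩ ?_).mp hx
  · exact inferInstanceAs (Module.Finite k (⊥ : Submodule A.carrierᵐᵒᵖ X))
  · intro N (hN : Module.Finite k N) N' (hN' : Module.Finite k N')
    refine ⟨N ⊔ N', ?_, le_sup_left, le_sup_right⟩
    have h1 : Module.Finite k (N.restrictScalars k) := hN
    have h2 : Module.Finite k (N'.restrictScalars k) := hN'
    have : Module.Finite k (N.restrictScalars k ⊔ N'.restrictScalars k : Submodule k X) :=
      inferInstance
    rwa [← Submodule.restrictScalars_sup] at this

/-- An elementwise description of the morphisms whose kernel and cokernel belong to `Fdim A`. -/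
theorem isoModFdim_iff {A : GradedAlg k} (hA : A.LocallyFinite) {M N : GrMod A} (f : M ⟶ N) :
    isoModFdim A f ↔
      (∀ x, f.toLin x = 0 → ∃ n₀ : ℕ, ∀ n ≥ n₀, ∀ a ∈ A.grading n, x <• a = 0) ∧
      (∀ y, ∃ n₀ : ℕ, ∀ n ≥ n₀, ∀ a ∈ A.grading n, ∃ x, f.toLin x = y <• a) := by
  constructor
  · rintro ⟨hk, hc⟩
    constructor
    · intro x hx
      obtain ⟨V, hV, hxV⟩ := exists_finite_mem_of_isSumOfFinDim hk ⟨x, hx⟩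
      have hV' : Module.Finite k (V.restrictScalars k) := hV
      obtain ⟨t, ht⟩ := Module.Finite.iff_fg.mp
        (Module.Finite.map (V.restrictScalars k)
          ((LinearMap.ker f.toLin).subtype.restrictScalars k))
      obtain ⟨n₀, hn⟩ := GrMod.exists_smul_mem_of_finite (M := M) ⊥ (by simp) x t (by
        intro a
        rw [sup_bot_eq, ht]
        exact ⟨_, V.smul_mem (MulOpposite.op a) hxV, rfl⟩)
      exact ⟨n₀, fun n hn' a ha => by simpa using hn n hn' a ha⟩
    · intro y
      obtain ⟨V, hV, hyV⟩ := exists_finite_mem_of_isSumOfFinDim hc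
        ((LinearMap.range f.toLin).mkQ y)
      have hV' : Module.Finite k (V.restrictScalars k) := hV
      obtain ⟨t, ht⟩ := Module.Finite.iff_fg.mp hV'
      classical
      have hsurj := (LinearMap.range f.toLin).mkQ_surjective
      -- The degree argument takes place in `N`, where the grading is available: a spanning set of
      -- `V` is lifted to `N` by a set-theoretic section, and the range of `f`, a homogeneous
      -- submodule, plays the role of `R`.
      obtain ⟨n₀, hn⟩ := GrMod.exists_smul_mem_of_finite (M := N)
        ((LinearMap.range f.toLin).restrictScalars k) (by
          rintro _ ⟨x, rfl⟩ j
          exact ⟨M.proj j x, (GrMod.Hom.map_proj f x j).symm⟩) y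
        (t.image (Function.surjInv hsurj)) (by
          intro a
          have h1 : (LinearMap.range f.toLin).mkQ (y <• a) ∈
              Submodule.span k (t : Set (N.carrier ⧸ LinearMap.range f.toLin)) := by
            rw [ht, map_smul]
            exact V.smul_mem _ hyV
          have h2 : (t : Set (N.carrier ⧸ LinearMap.range f.toLin)) =
              (LinearMap.range f.toLin).mkQ.restrictScalars k ''
                (t.image (Function.surjInv hsurj)) := by
            rw [Finset.coe_image, Set.image_image]
            simp [Function.surjInv_eq]
          rw [h2, Submodule.span_image] at h1
          obtain ⟨z, hz, hzy⟩ := h1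
          refine Submodule.mem_sup.mpr ⟨z, hz, y <• a - z, ?_, by simp⟩
          have : (LinearMap.range f.toLin).mkQ (y <• a - z) = 0 := by
            rw [map_sub, sub_eq_zero]; exact hzy.symm
          exact (Submodule.Quotient.mk_eq_zero _).mp this)
      exact ⟨n₀, fun n hn' a ha => hn n hn' a ha⟩
  · rintro ⟨hk, hc⟩
    constructor
    · refine isSumOfFinDim_of_smul_eq_zero A hA _ ?_
      rintro ⟨x, hx⟩
      obtain ⟨n₀, h⟩ := hk x hx
      exact ⟨n₀, fun n hn a ha => Subtype.ext (h n hn a ha)⟩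
    · refine isSumOfFinDim_of_smul_eq_zero A hA _ fun y => ?_
      obtain ⟨y, rfl⟩ := Submodule.mkQ_surjective _ y
      obtain ⟨n₀, h⟩ := hc y
      refine ⟨n₀, fun n hn a ha => ?_⟩
      rw [← map_smul]
      obtain ⟨x, hx⟩ := h n hn a ha
      exact (Submodule.Quotient.mk_eq_zero _).mpr ⟨x, hx⟩

/-! ### Restriction and coinduction along a homomorphism that need not preserve the unit -/

namespace GrMod

theorem rsmul_mul {A : GradedAlg k} {M : GrMod A} (x : M.carrier) (a b : A.carrier) :
    x <• (a * b) = (x <• a) <• b := by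
  rw [MulOpposite.op_mul, mul_smul]

theorem rsmul_add {A : GradedAlg k} {M : GrMod A} (x : M.carrier) (a b : A.carrier) :
    x <• (a + b) = x <• a + x <• b := by
  rw [MulOpposite.op_add, add_smul]

theorem rsmul_one {A : GradedAlg k} {M : GrMod A} (x : M.carrier) :
    x <• (1 : A.carrier) = x := by
  rw [MulOpposite.op_one, one_smul]

theorem rsmul_k {A : GradedAlg k} {M : GrMod A} (c : k) (x : M.carrier) (a : A.carrier) :
    x <• (c • a) = c • (x <• a) := by
  rw [MulOpposite.op_smul, smul_assoc]

/-- The action on a fixed element of a graded module, as a `k`-linear map. -/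
def orbitMap {A : GradedAlg k} (M : GrMod A) (x : M.carrier) : A.carrier →ₗ[k] M.carrier where
  toFun a := x <• a
  map_add' := rsmul_add x
  map_smul' c a := rsmul_k c x a

end GrMod

/-- A homomorphism of graded algebras that need not preserve the unit. -/
structure GrNUHom (A B : GradedAlg k) where
  /-- the underlying homomorphism -/
  toHom : A.carrier →ₙₐ[k] B.carrier
  map_mem : ∀ {n : ℕ} {a : A.carrier}, a ∈ A.grading n → toHom a ∈ B.grading n

namespace GrNUHom

open GrMod

variable {A B : GradedAlg k} (f : GrNUHom A B)

instance : CoeFun (GrNUHom A B) fun _ => A.carrier → B.carrier := ⟨fun f => f.toHom⟩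

theorem map_one_mul (a : A.carrier) : f 1 * f a = f a := by rw [← map_mul, one_mul]
theorem map_mul_one (a : A.carrier) : f a * f 1 = f a := by rw [← map_mul, mul_one]

/-! #### Restriction -/

/-- The part `N e` of a right module `N`, where `e` is the image of the unit. -/
def resSubmodule (N : GrMod B) : Submodule k N.carrier :=
  LinearMap.eqLocus (N.mulRight (f 1)) LinearMap.id

/-- The underlying space of the restriction of a right module. -/
def ResCarrier (N : GrMod B) : Type u := f.resSubmodule N

instance (N : GrMod B) : AddCommGroup (f.ResCarrier N) :=
  inferInstanceAs (AddCommGroup (f.resSubmodule N))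
instance (N : GrMod B) : Module k (f.ResCarrier N) :=
  inferInstanceAs (Module k (f.resSubmodule N))

/-- The inclusion of `N e` into `N`. -/
def resVal (N : GrMod B) : f.ResCarrier N →ₗ[k] N.carrier := (f.resSubmodule N).subtype

theorem resVal_injective (N : GrMod B) : Function.Injective (f.resVal N) :=
  Subtype.val_injective

theorem resVal_smul_one {N : GrMod B} (x : f.ResCarrier N) :
    f.resVal N x <• f 1 = f.resVal N x := x.2

/-- The element of `N e` given by an element of `N` fixed by `e`. -/
def resMk {N : GrMod B} (x : N.carrier) (hx : x <• f 1 = x) : f.ResCarrier N := ⟨x, hx⟩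

theorem smul_map_mem {N : GrMod B} (x : N.carrier) (a : A.carrier) :
    (x <• f a) <• f 1 = x <• f a := by
  rw [← rsmul_mul, map_mul_one]

instance (N : GrMod B) : SMul A.carrierᵐᵒᵖ (f.ResCarrier N) :=
  ⟨fun a x => f.resMk (f.resVal N x <• f a.unop) (f.smul_map_mem _ _)⟩

instance (N : GrMod B) : Module A.carrierᵐᵒᵖ (f.ResCarrier N) where
  one_smul x := f.resVal_injective N (f.resVal_smul_one x)
  mul_smul a b x := f.resVal_injective N (by
    change f.resVal N x <• f (b.unop * a.unop) = _
    rw [map_mul, rsmul_mul]; rfl)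
  smul_zero a := f.resVal_injective N (smul_zero _)
  smul_add a x y := f.resVal_injective N (smul_add _ _ _)
  add_smul a b x := f.resVal_injective N (by
    change f.resVal N x <• f (a.unop + b.unop) = _
    rw [map_add, rsmul_add]; rfl)
  zero_smul x := f.resVal_injective N (by
    change f.resVal N x <• f 0 = _
    rw [map_zero, MulOpposite.op_zero, zero_smul]; rfl)

instance (N : GrMod B) : IsScalarTower k A.carrierᵐᵒᵖ (f.ResCarrier N) where
  smul_assoc c a x := f.resVal_injective N (by
    change f.resVal N x <• f (c • a.unop) = c • (f.resVal N x <• f a.unop)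
    rw [map_smul, rsmul_k])

theorem one_mem_grading (A : GradedAlg k) : (1 : A.carrier) ∈ A.grading 0 :=
  SetLike.GradedOne.one_mem

/-- Restriction of a graded right module. -/
def resObj (N : GrMod B) : GrMod A where
  carrier := f.ResCarrier N
  grading i := (N.grading i).comap (f.resVal N)
  isInternal := by
    refine isInternal_of_separated (N := N.carrier) _ ?_ ?_
    · rw [eq_top_iff]
      intro x _
      obtain ⟨s, -, hs⟩ := exists_finset_proj (f.resVal N x)
      -- The idempotent `f 1` has degree 0, so the components of an element fixed by it are fixed as
      -- well.
      have hp : ∀ j, N.proj j (f.resVal N x) <• f 1 = N.proj j (f.resVal N x) := fun j => by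
        have := proj_smul (f.map_mem (one_mem_grading A)) (f.resVal N x) j
        rw [resVal_smul_one] at this
        simpa using this.symm
      have : x = ∑ j ∈ s, f.resMk _ (hp j) := by
        apply f.resVal_injective
        rw [map_sum]
        exact hs.symm
      rw [this]
      refine Submodule.sum_mem _ fun j _ => Submodule.mem_iSup_of_mem j ?_
      exact proj_mem (M := N) j _
    · intro i x hx hne
      refine ⟨(N.proj i).comp (f.resVal N), ?_, ?_⟩
      · intro j hj y hy
        exact proj_of_mem_of_ne hj.symm hy
      · rw [LinearMap.comp_apply, proj_of_mem hx]
        exact fun h => hne (f.resVal_injective N (h.trans (map_zero _).symm))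
  smul_mem hm ha := N.smul_mem hm (f.map_mem ha)

/-- Restriction, as a functor. -/
def res : GrMod B ⥤ GrMod A where
  obj := f.resObj
  map {N N'} g :=
    { toLin :=
        { toFun := fun x => f.resMk (g.toLin (f.resVal N x)) 
            ((Hom.map_smul' g _ _).symm.trans (congrArg g.toLin (f.resVal_smul_one x)))
          map_add' := fun x y => f.resVal_injective N'
            (map_add g.toLin (f.resVal N x) (f.resVal N y))
          map_smul' := fun a x => f.resVal_injective N'
            (Hom.map_smul' g (f.resVal N x) (f a.unop)) }
      map_mem := fun h => g.map_mem h }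

/-- Restriction commutes with the shift. -/
def resShift : GrMod.shift B ⋙ f.res ≅ f.res ⋙ GrMod.shift A :=
  NatIso.ofComponents (fun N =>
    { hom := ⟨LinearMap.id, fun h => h⟩
      inv := ⟨LinearMap.id, fun h => h⟩ })

/-! #### Coinduction -/

/-- The homomorphisms of degree `i` of right `A`-modules from `B e` to `M`; they are regarded as
maps on the whole of `B`. -/
def homDeg (M : GrMod A) (i : ℤ) : Submodule k (B.carrier →ₗ[k] M.carrier) where
  carrier := {φ | (∀ b a, φ (b * f a) = φ b <• a) ∧
    ∀ n, ∀ b ∈ B.grading n, φ b ∈ M.grading (i + n)}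
  add_mem' hφ hψ := ⟨fun b a => by simp [hφ.1, hψ.1],
    fun n b hb => Submodule.add_mem _ (hφ.2 n b hb) (hψ.2 n b hb)⟩
  zero_mem' := ⟨by simp, by simp⟩
  smul_mem' c φ hφ := ⟨fun b a => by
      simp only [LinearMap.smul_apply, hφ.1]; exact (smul_k_smul _ _ _).symm,
    fun n b hb => Submodule.smul_mem _ c (hφ.2 n b hb)⟩

/-- The sums of homogeneous homomorphisms from `B e` to `M`. -/
def coindSubmodule (M : GrMod A) : Submodule k (B.carrier →ₗ[k] M.carrier) :=
  ⨆ i, f.homDeg M i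

theorem apply_mul_map_of_mem {M : GrMod A} {φ : B.carrier →ₗ[k] M.carrier}
    (hφ : φ ∈ f.coindSubmodule M) (b : B.carrier) (a : A.carrier) :
    φ (b * f a) = φ b <• a := by
  induction hφ using Submodule.iSup_induction' with
  | mem i φ hφ => exact hφ.1 b a
  | zero => simp
  | add φ ψ _ _ h1 h2 => simp [h1, h2]

/-- Left multiplication by an element of degree `n` turns a homomorphism of degree `i` into one of
degree `i + n`. This makes the right `B`-action on the coinduction well defined. -/
theorem comp_mulLeft_mem {M : GrMod A} {φ : B.carrier →ₗ[k] M.carrier}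
    (hφ : φ ∈ f.coindSubmodule M) (b : B.carrier) :
    φ ∘ₗ LinearMap.mulLeft k b ∈ f.coindSubmodule M := by
  induction b using GradedAlg.induction_homogeneous with
  | mem n b hb =>
    induction hφ using Submodule.iSup_induction' with
    | mem i φ hφ =>
      refine Submodule.mem_iSup_of_mem (i + n) ⟨fun c a => ?_, fun j c hc => ?_⟩
      · simp [← mul_assoc, hφ.1]
      · have := hφ.2 _ _ (SetLike.mul_mem_graded hb hc)
        simpa [add_assoc] using this
    | zero => simp
    | add φ ψ _ _ h1 h2 => rw [LinearMap.add_comp]; exact Submodule.add_mem _ h1 h2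
  | zero => simp
  | add b c hb hc =>
    have : LinearMap.mulLeft k (b + c) = LinearMap.mulLeft k b + LinearMap.mulLeft k c := by
      ext; simp [add_mul]
    rw [this, LinearMap.comp_add]
    exact Submodule.add_mem _ hb hc

/-- The underlying space of the coinduction of a graded right module. -/
def CoindCarrier (M : GrMod A) : Type u := f.coindSubmodule M

instance (M : GrMod A) : AddCommGroup (f.CoindCarrier M) :=
  inferInstanceAs (AddCommGroup (f.coindSubmodule M))
instance (M : GrMod A) : Module k (f.CoindCarrier M) :=
  inferInstanceAs (Module k (f.coindSubmodule M))

/-- The linear map on `B` underlying an element of the coinduction. -/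
def coindVal (M : GrMod A) : f.CoindCarrier M →ₗ[k] (B.carrier →ₗ[k] M.carrier) :=
  (f.coindSubmodule M).subtype

theorem coindVal_injective (M : GrMod A) : Function.Injective (f.coindVal M) :=
  Subtype.val_injective

theorem coind_ext {M : GrMod A} {φ ψ : f.CoindCarrier M}
    (h : ∀ b, f.coindVal M φ b = f.coindVal M ψ b) : φ = ψ :=
  f.coindVal_injective M (LinearMap.ext h)

theorem coindVal_mul_map {M : GrMod A} (φ : f.CoindCarrier M) (b : B.carrier) (a : A.carrier) :
    f.coindVal M φ (b * f a) = f.coindVal M φ b <• a :=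
  f.apply_mul_map_of_mem φ.2 b a

theorem coindVal_mul_one {M : GrMod A} (φ : f.CoindCarrier M) (b : B.carrier) :
    f.coindVal M φ (b * f 1) = f.coindVal M φ b := by
  rw [coindVal_mul_map, rsmul_one]

instance (M : GrMod A) : SMul B.carrierᵐᵒᵖ (f.CoindCarrier M) :=
  ⟨fun b φ => ⟨f.coindVal M φ ∘ₗ LinearMap.mulLeft k b.unop, f.comp_mulLeft_mem φ.2 _⟩⟩

theorem coindVal_smul {M : GrMod A} (φ : f.CoindCarrier M) (b x : B.carrier) :
    f.coindVal M (φ <• b) x = f.coindVal M φ (b * x) := rfl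

instance (M : GrMod A) : Module B.carrierᵐᵒᵖ (f.CoindCarrier M) where
  one_smul φ := f.coind_ext fun x => congrArg (f.coindVal M φ) (one_mul x)
  mul_smul a b φ := f.coind_ext fun x =>
    congrArg (f.coindVal M φ) (mul_assoc b.unop a.unop x)
  smul_zero _ := f.coind_ext fun _ => rfl
  smul_add _ _ _ := f.coind_ext fun _ => rfl
  add_smul a b φ := f.coind_ext fun x =>
    (congrArg (f.coindVal M φ) (add_mul a.unop b.unop x)).trans (map_add _ _ _)
  zero_smul φ := f.coind_ext fun x =>
    (congrArg (f.coindVal M φ) (zero_mul x)).trans (map_zero _)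

instance (M : GrMod A) : IsScalarTower k B.carrierᵐᵒᵖ (f.CoindCarrier M) where
  smul_assoc c b φ := f.coind_ext fun x =>
    (congrArg (f.coindVal M φ) (smul_mul_assoc c b.unop x)).trans (map_smul _ _ _)

/-- Coinduction of a graded right module. -/
def coindObj (M : GrMod A) : GrMod B where
  carrier := f.CoindCarrier M
  grading i := (f.homDeg M i).comap (f.coindVal M)
  isInternal := by
    refine isInternal_of_separated (N := M.carrier) _
      (iSup_comap_subtype_eq_top _ (f.coindSubmodule M) rfl) ?_
    intro i φ hφ hne
    -- A nonzero homomorphism of degree `i` is nonzero at some homogeneous `b`, of degree `n` say.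
    -- Evaluation at `b` followed by the projection to degree `i + n` vanishes on homomorphisms of
    -- every other degree.
    obtain ⟨n, b, hb, hb'⟩ : ∃ n, ∃ b ∈ B.grading n, f.coindVal M φ b ≠ 0 := by
      by_contra! h
      refine hne (f.coind_ext fun b => ?_)
      induction b using GradedAlg.induction_homogeneous with
      | mem n b hb => rw [h n b hb]; rfl
      | zero => simp
      | add b c hb hc => rw [map_add, map_add, hb, hc]
    refine ⟨(M.proj (i + n)).comp ((LinearMap.applyₗ b).comp (f.coindVal M)), ?_, ?_⟩
    · intro j hj ψ hψ
      exact proj_of_mem_of_ne (by omega) (hψ.2 n b hb)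
    · change M.proj (i + n) (f.coindVal M φ b) ≠ 0
      rwa [proj_of_mem (hφ.2 n b hb)]
  smul_mem {i n φ b} hφ hb := by
    refine ⟨fun c a => ?_, fun j c hc => ?_⟩
    · rw [coindVal_smul, coindVal_smul, ← mul_assoc, coindVal_mul_map]
    · have := hφ.2 _ _ (SetLike.mul_mem_graded hb hc)
      rw [coindVal_smul]
      simpa [add_assoc] using this

theorem comp_mem_homDeg {M M' : GrMod A} (g : M ⟶ M') {i : ℤ} {φ : B.carrier →ₗ[k] M.carrier}
    (hφ : φ ∈ f.homDeg M i) : g.toLinK ∘ₗ φ ∈ f.homDeg M' i :=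
  ⟨fun b a => by
    change g.toLin (φ (b * f a)) = _
    rw [hφ.1, Hom.map_smul']; rfl,
  fun n b hb => g.map_mem (hφ.2 n b hb)⟩

theorem comp_mem_coindSubmodule {M M' : GrMod A} (g : M ⟶ M') {φ : B.carrier →ₗ[k] M.carrier}
    (hφ : φ ∈ f.coindSubmodule M) : g.toLinK ∘ₗ φ ∈ f.coindSubmodule M' := by
  induction hφ using Submodule.iSup_induction' with
  | mem i φ hφ => exact Submodule.mem_iSup_of_mem i (f.comp_mem_homDeg g hφ)
  | zero => simp
  | add φ ψ _ _ h1 h2 => rw [LinearMap.comp_add]; exact Submodule.add_mem _ h1 h2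

/-- Coinduction, as a functor. -/
def coind : GrMod A ⥤ GrMod B where
  obj := f.coindObj
  map {M M'} g :=
    { toLin :=
        { toFun := fun φ => ⟨g.toLinK ∘ₗ f.coindVal M φ, f.comp_mem_coindSubmodule g φ.2⟩
          map_add' := fun φ ψ => f.coind_ext fun b => map_add g.toLin _ _
          map_smul' := fun b φ => rfl }
      map_mem := fun h => f.comp_mem_homDeg g h }

/-- The map `x ↦ z x e` from `B` to `N e`. -/
def unitFun (N : GrMod B) (z : N.carrier) : B.carrier →ₗ[k] (f.resObj N).carrier where
  toFun x := f.resMk (z <• x <• f 1) (f.smul_map_mem _ _)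
  map_add' x y := f.resVal_injective N (by
    change (z <• (x + y)) <• f 1 = z <• x <• f 1 + z <• y <• f 1
    rw [rsmul_add, smul_add])
  map_smul' c x := f.resVal_injective N (by
    change (z <• (c • x)) <• f 1 = c • (z <• x <• f 1)
    rw [rsmul_k, smul_k_smul])

theorem unitFun_mem_homDeg {N : GrMod B} {i : ℤ} {z : N.carrier} (hz : z ∈ N.grading i) :
    f.unitFun N z ∈ f.homDeg (f.resObj N) i := by
  refine ⟨fun b a => f.resVal_injective N ?_, fun n b hb => ?_⟩
  · change (z <• (b * f a)) <• f 1 = (z <• b <• f 1) <• f a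
    rw [← rsmul_mul, ← rsmul_mul, ← rsmul_mul, mul_assoc, map_mul_one, map_one_mul]
  · change (z <• b) <• f 1 ∈ N.grading _
    have := N.smul_mem (N.smul_mem hz hb) (f.map_mem (one_mem_grading A))
    simpa using this

theorem unitFun_add {N : GrMod B} (x y : N.carrier) :
    f.unitFun N (x + y) = f.unitFun N x + f.unitFun N y :=
  LinearMap.ext fun b => f.resVal_injective N (by
    change (x + y) <• b <• f 1 = x <• b <• f 1 + y <• b <• f 1
    simp)

theorem unitFun_mem {N : GrMod B} (z : N.carrier) :
    f.unitFun N z ∈ f.coindSubmodule (f.resObj N) := by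
  induction z using GrMod.induction_homogeneous with
  | mem i z hz => exact Submodule.mem_iSup_of_mem i (f.unitFun_mem_homDeg hz)
  | zero =>
    convert Submodule.zero_mem _
    refine LinearMap.ext fun x => f.resVal_injective N ?_
    change ((0 : N.carrier) <• x) <• f 1 = 0
    simp
  | add x y hx hy => rw [unitFun_add]; exact Submodule.add_mem _ hx hy

/-- The unit of the adjunction between restriction and coinduction. -/
def unit : 𝟭 (GrMod B) ⟶ f.res ⋙ f.coind where
  app N :=
    { toLin :=
        { toFun := fun z => ⟨f.unitFun N z, f.unitFun_mem z⟩
          map_add' := fun x y => f.coindVal_injective _ (f.unitFun_add x y)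
          map_smul' := fun b x => f.coind_ext fun c => f.resVal_injective N (by
            change (b • x) <• c <• f 1 = x <• (b.unop * c) <• f 1
            rw [rsmul_mul]; rfl) }
      map_mem := fun hz => f.unitFun_mem_homDeg hz }
  naturality N N' g := by
    apply Hom.ext
    ext z
    refine f.coind_ext fun b => f.resVal_injective N' ?_
    change (g.toLin z) <• b <• f 1 = g.toLin (z <• b <• f 1)
    rw [Hom.map_smul', Hom.map_smul']

/-- The counit of the adjunction between restriction and coinduction. -/
def counit : f.coind ⋙ f.res ⟶ 𝟭 (GrMod A) where
  app M :=
    { toLin :=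
        { toFun := fun φ => f.coindVal M (f.resVal (f.coindObj M) φ) 1
          map_add' := fun φ ψ => rfl
          map_smul' := fun a φ => by
            have h := f.coindVal_mul_map (f.resVal (f.coindObj M) φ) 1 a.unop
            rw [one_mul] at h
            exact (congrArg (f.coindVal M (f.resVal (f.coindObj M) φ)) (mul_one _)).trans h }
      map_mem := fun {i φ} hφ => by
        have := hφ.2 0 1 (one_mem_grading B)
        rwa [Nat.cast_zero, add_zero] at this }
  naturality M M' g := rfl

end GrNUHom

/-! ### Homomorphisms inducing an equivalence of the quotient categories -/

/-- Conditions, on a homomorphism `f` of graded algebras that need not preserve the unit, under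
which restriction along `f` induces an equivalence of the quotient categories. -/
structure GrNUHom.IsTailEquiv {A B : GradedAlg k} (f : GrNUHom A B) (m : ℕ) : Prop where
  finite_source : A.LocallyFinite
  finite_target : B.LocallyFinite
  exists_lift : ∀ n ≥ m, ∀ a ∈ A.grading n, ∃ L : B.carrier →ₗ[k] A.carrier,
    L 1 = a ∧ (∀ b a', L (b * f a') = L b * a') ∧
    (∀ j, ∀ b ∈ B.grading j, L b ∈ A.grading (n + j)) ∧ ∀ b, f (L b) = f a * b * f 1
  exists_generators : ∃ T : Finset B.carrier, ∀ n, ∃ n₀, ∀ j ≥ n₀, ∀ b ∈ B.grading j,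
    b ∈ Submodule.span k {x : B.carrier | ∃ q ∈ T, ∃ i ≥ n, ∃ a ∈ A.grading i,
      ∃ i' ≥ m, ∃ a' ∈ A.grading i', ∃ c, x = q * f a * f a' * c}

namespace GrNUHom

open GrMod

variable {A B : GradedAlg k} {f : GrNUHom A B}

/-- An element `y` of `M` and a linear map `L` from `B` to `A` as in
`GrNUHom.IsTailEquiv.exists_lift` define the element `x ↦ y L(x)` of the coinduction of `M`. -/
theorem exists_coind_apply {n : ℕ} {L : B.carrier →ₗ[k] A.carrier}
    (h1 : ∀ b a', L (b * f a') = L b * a')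
    (h2 : ∀ j, ∀ b ∈ B.grading j, L b ∈ A.grading (n + j)) {M : GrMod A} (y : M.carrier) :
    ∃ φ : f.CoindCarrier M, ∀ x, f.coindVal M φ x = y <• L x := by
  suffices H : M.orbitMap y ∘ₗ L ∈ f.coindSubmodule M from ⟨⟨_, H⟩, fun x => rfl⟩
  induction y using GrMod.induction_homogeneous with
  | mem i y hy =>
    refine Submodule.mem_iSup_of_mem (i + n) ⟨fun b a => ?_, fun j b hb => ?_⟩
    · change y <• L (b * f a) = (y <• L b) <• a
      rw [h1, rsmul_mul]
    · have := M.smul_mem hy (h2 j b hb)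
      change y <• L b ∈ _
      rwa [Nat.cast_add, ← add_assoc] at this
  | zero =>
    convert Submodule.zero_mem _
    ext x
    exact smul_zero _
  | add x y hx hy =>
    convert Submodule.add_mem _ hx hy
    ext x
    exact smul_add _ _ _

/-- The action of an element of the form `q f(a) f(a') c` on an element of the coinduction. -/
theorem coindVal_factor {a' : A.carrier} {L : B.carrier →ₗ[k] A.carrier}
    (h3 : ∀ b, f (L b) = f a' * b * f 1) {M : GrMod A} (φ : f.CoindCarrier M)
    (q : B.carrier) (a : A.carrier) (c x : B.carrier) :
    f.coindVal M φ (q * f a * f a' * c * x) = f.coindVal M φ q <• a <• L (c * x) := by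
  -- Elements of the coinduction only see `B e`, so a factor `f 1` may be inserted on the right.
  -- Then `f a' * (c * x) * f 1` is `f (L (c * x))`, which `φ` takes out as an action of `A`.
  rw [← coindVal_mul_one, ← coindVal_mul_map, ← coindVal_mul_map, h3]
  simp only [mul_assoc]

theorem rsmul_mem_of_span {A : GradedAlg k} {M : GrMod A} (R : Submodule k M.carrier)
    (x : M.carrier) {s : Set A.carrier} (h : ∀ a ∈ s, x <• a ∈ R) {a : A.carrier}
    (ha : a ∈ Submodule.span k s) : x <• a ∈ R := by
  have : Submodule.span k s ≤ R.comap (M.orbitMap x) := Submodule.span_le.mpr h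
  exact this ha

/-- The range of a homomorphism of graded modules as a `k`-subspace. -/
theorem mem_range_toLinK {A : GradedAlg k} {M N : GrMod A} (g : M ⟶ N) (y : N.carrier) :
    y ∈ LinearMap.range (Hom.toLinK g) ↔ ∃ x, g.toLin x = y := Iff.rfl

/-- Makes the torsion bounds for the values `φ(q)` uniform in `q ∈ T`; this is where the finiteness
of the set of left factors is needed. -/
theorem exists_bound {α : Type*} (T : Finset α) {P : α → ℕ → Prop}
    (hP : ∀ a n n', n ≤ n' → P a n → P a n') (h : ∀ a, ∃ n, P a n) : ∃ n, ∀ a ∈ T, P a n := by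
  choose N hN using h
  exact ⟨T.sup N, fun a ha => hP a _ _ (Finset.le_sup ha) (hN a)⟩

namespace IsTailEquiv

variable {m : ℕ} (hf : f.IsTailEquiv m)

include hf

/-- Bounds for `B` are bounds for `A`, since `f` preserves degrees. A preimage `x` of `y f(a)` need
not lie in `N e`, but `x e` does and has the same image. -/
theorem isoModFdim_res {N N' : GrMod B} (g : N ⟶ N') (hg : isoModFdim B g) :
    isoModFdim A (f.res.map g) := by
  rw [isoModFdim_iff hf.finite_target] at hg
  rw [isoModFdim_iff hf.finite_source]
  constructor
  · intro x hx
    obtain ⟨n₀, h⟩ := hg.1 (f.resVal N x) (congrArg (f.resVal N') hx)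
    exact ⟨n₀, fun n hn a ha => f.resVal_injective N (h n hn _ (f.map_mem ha))⟩
  · intro y
    obtain ⟨n₀, h⟩ := hg.2 (f.resVal N' y)
    refine ⟨n₀, fun n hn a ha => ?_⟩
    obtain ⟨x, hx⟩ := h n hn _ (f.map_mem ha)
    refine ⟨f.resMk (x <• f 1) (f.smul_map_mem _ _), f.resVal_injective N' ?_⟩
    change g.toLin (x <• f 1) = f.resVal N' y <• f a
    rw [Hom.map_smul', hx, smul_map_mem]

/-- Choose `n` such that, for all `q ∈ T`, the products `φ(q) a` with `deg a ≥ n` vanish (for the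
kernel) or have the form `g(y)` (for the cokernel). Acting on `φ` by `q f(a) f(a') c` gives `x ↦
φ(q) a L(c x)`, which is then zero, respectively the image of `x ↦ y L(c x)`. Elements of `B` of
large degree are combinations of such products. -/
theorem isoModFdim_coind {M M' : GrMod A} (g : M ⟶ M') (hg : isoModFdim A g) :
    isoModFdim B (f.coind.map g) := by
  rw [isoModFdim_iff hf.finite_source] at hg
  rw [isoModFdim_iff hf.finite_target]
  obtain ⟨T, hT⟩ := hf.exists_generators
  constructor
  · intro (φ : f.CoindCarrier M) hφ
    obtain ⟨n, hn⟩ := exists_bound T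
      (P := fun q n => ∀ i ≥ n, ∀ a ∈ A.grading i, f.coindVal M φ q <• a = 0)
      (fun _ _ _ h h' i hi => h' i (h.trans hi))
      (fun q => hg.1 _ (congrArg (fun ψ => f.coindVal M' ψ q) hφ))
    obtain ⟨n₀, h⟩ := hT n
    refine ⟨n₀, fun j hj b hb => ?_⟩
    rw [← Submodule.mem_bot k]
    refine rsmul_mem_of_span (M := f.coindObj M) ⊥ φ ?_ (h j hj b hb)
    rintro _ ⟨q, hq, i, hi, a, ha, i', hi', a', ha', c, rfl⟩
    rw [Submodule.mem_bot]
    refine f.coind_ext fun x => ?_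
    obtain ⟨L, -, -, -, h3⟩ := hf.exists_lift i' hi' a' ha'
    refine (coindVal_factor h3 φ q a c x).trans ?_
    rw [hn q hq i hi a ha, smul_zero]
    rfl
  · intro (φ : f.CoindCarrier M')
    obtain ⟨n, hn⟩ := exists_bound T
      (P := fun q n => ∀ i ≥ n, ∀ a ∈ A.grading i, ∃ y, g.toLin y = f.coindVal M' φ q <• a)
      (fun _ _ _ h h' i hi => h' i (h.trans hi)) (fun q => hg.2 _)
    obtain ⟨n₀, h⟩ := hT n
    refine ⟨n₀, fun j hj b hb => ?_⟩
    rw [← mem_range_toLinK]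
    refine rsmul_mem_of_span (M := f.coindObj M') _ φ ?_ (h j hj b hb)
    rintro _ ⟨q, hq, i, hi, a, ha, i', hi', a', ha', c, rfl⟩
    obtain ⟨L, -, h1, h2, h3⟩ := hf.exists_lift i' hi' a' ha'
    obtain ⟨y, hy⟩ := hn q hq i hi a ha
    obtain ⟨ψ, hψ⟩ := exists_coind_apply h1 h2 y
    refine ⟨ψ <• c, f.coind_ext fun x => ?_⟩
    refine Eq.trans ?_ (coindVal_factor h3 φ q a c x).symm
    rw [← hy, ← Hom.map_smul']
    exact congrArg g.toLin (hψ (c * x))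

/-- An element `z` of the kernel satisfies `z B e = 0`, hence is killed by `q f(a) = q f(a) e`. For
the cokernel, the action of `q f(a) f(a') c` on `φ` gives the image under the unit of `(φ(q) a)
f(a') c`, because `f(L(c x)) = f(a') c x e`. -/
theorem isoModFdim_unit (N : GrMod B) : isoModFdim B (f.unit.app N) := by
  rw [isoModFdim_iff hf.finite_target]
  obtain ⟨T, hT⟩ := hf.exists_generators
  obtain ⟨n₀, h⟩ := hT 0
  constructor
  · intro z hz
    refine ⟨n₀, fun j hj b hb => ?_⟩
    rw [← Submodule.mem_bot k]
    refine rsmul_mem_of_span (M := N) ⊥ z ?_ (h j hj b hb)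
    rintro _ ⟨q, hq, i, hi, a, ha, i', hi', a', ha', c, rfl⟩
    rw [Submodule.mem_bot]
    have := congrArg (fun ψ => f.resVal N (f.coindVal (f.resObj N) ψ (q * f a))) hz
    change z <• (q * f a) <• f 1 = 0 at this
    rw [← rsmul_mul, mul_assoc, map_mul_one] at this
    rw [mul_assoc, rsmul_mul, this, smul_zero]
  · intro (φ : f.CoindCarrier (f.resObj N))
    refine ⟨n₀, fun j hj b hb => ?_⟩
    rw [← mem_range_toLinK]
    refine rsmul_mem_of_span (M := f.coindObj (f.resObj N)) _ φ ?_ (h j hj b hb)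
    rintro _ ⟨q, hq, i, hi, a, ha, i', hi', a', ha', c, rfl⟩
    obtain ⟨L, -, h1, h2, h3⟩ := hf.exists_lift i' hi' a' ha'
    refine ⟨f.resVal N (f.coindVal (f.resObj N) φ q <• a) <• (f a' * c),
      f.coind_ext fun x => ?_⟩
    refine Eq.trans ?_ (coindVal_factor h3 φ q a c x).symm
    apply f.resVal_injective N
    change (f.resVal N _ <• (f a' * c)) <• x <• f 1 = f.resVal N _ <• f (L (c * x))
    rw [h3, ← rsmul_mul, ← rsmul_mul]
    simp only [mul_assoc]

/-- The counit is evaluation at 1. If `φ(1) = 0`, then `φ(f(a) x) = φ(f(L x)) = φ(1) L(x) = 0`, so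
`a` kills `φ`. Conversely `y a = y L(1)` is the value at 1 of the map `x ↦ y L(x)`, once that map is
multiplied by `e` to lie in the restriction. -/
theorem isoModFdim_counit (M : GrMod A) : isoModFdim A (f.counit.app M) := by
  rw [isoModFdim_iff hf.finite_source]
  constructor
  · intro (φ : f.ResCarrier (f.coindObj M)) hφ
    refine ⟨m, fun n hn a ha => ?_⟩
    obtain ⟨L, -, -, -, h3⟩ := hf.exists_lift n hn a ha
    apply f.resVal_injective
    refine f.coind_ext fun x => ?_
    have h := f.coindVal_mul_one (f.resVal (f.coindObj M) φ) (f a * x)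
    rw [← h3, ← one_mul (f (L x))] at h
    refine h.symm.trans ((f.coindVal_mul_map (f.resVal (f.coindObj M) φ) 1 (L x)).trans ?_)
    exact (congrArg (fun y : M.carrier => y <• L x) hφ).trans (smul_zero _)
  · intro (y : M.carrier)
    refine ⟨m, fun n hn a ha => ?_⟩
    obtain ⟨L, h0, h1, h2, h3⟩ := hf.exists_lift n hn a ha
    obtain ⟨ψ, hψ⟩ := exists_coind_apply h1 h2 y
    refine ⟨f.resMk (N := f.coindObj M) (ψ <• f 1) ?_, ?_⟩
    · exact (rsmul_mul (M := f.coindObj M) ψ (f 1) (f 1)).symm.trans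
        (congrArg (fun b => (show (f.coindObj M).carrier from ψ) <• b) (f.map_mul_one 1))
    · change f.coindVal M ψ (f 1 * 1) = _
      rw [hψ, mul_one, ← one_mul (f 1), h1, h0, mul_one]

end IsTailEquiv

end GrNUHom

/-! ### Passage to the quotient categories -/

/-- The existence of an equivalence of the quotient categories that commutes with the shifts. -/
def QGrEquiv (A B : GradedAlg k) : Prop :=
  ∃ F : QGr A ≌ QGr B, Nonempty (QGr.shift A ⋙ F.functor ≅ F.functor ⋙ QGr.shift B)

theorem QGrEquiv.symm {A B : GradedAlg k} (h : QGrEquiv A B) : QGrEquiv B A := by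
  obtain ⟨F, ⟨α⟩⟩ := h
  let c : CatCommSq F.functor (QGr.shift A) (QGr.shift B) F.functor := ⟨α.symm⟩
  exact ⟨F.symm, ⟨(CatCommSq.hInv F _ _ F c).iso.symm⟩⟩

theorem QGrEquiv.trans {A B C : GradedAlg k} (h : QGrEquiv A B) (h' : QGrEquiv B C) :
    QGrEquiv A C := by
  obtain ⟨F, ⟨α⟩⟩ := h
  obtain ⟨G, ⟨β⟩⟩ := h'
  exact ⟨F.trans G, ⟨(Functor.associator _ _ _).symm ≪≫ Functor.isoWhiskerRight α _ ≪≫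
    Functor.associator _ _ _ ≪≫ Functor.isoWhiskerLeft _ β ≪≫ (Functor.associator _ _ _).symm⟩⟩

namespace GrNUHom.IsTailEquiv

variable {A B : GradedAlg k} {f : GrNUHom A B} {m : ℕ} (hf : f.IsTailEquiv m)

include hf

/-- Restriction and coinduction descend to the localizations. The unit and the counit become
isomorphisms there, so the induced functors are mutually inverse. -/
theorem qGrEquiv : QGrEquiv B A := by
  have hres : (isoModFdim B).IsInvertedBy (f.res ⋙ (isoModFdim A).Q) := fun _ _ g hg =>
    (isoModFdim A).Q_inverts _ (hf.isoModFdim_res g hg)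
  have hcoind : (isoModFdim A).IsInvertedBy (f.coind ⋙ (isoModFdim B).Q) := fun _ _ g hg =>
    (isoModFdim B).Q_inverts _ (hf.isoModFdim_coind g hg)
  have hu (N : GrMod B) : IsIso ((isoModFdim B).Q.map (f.unit.app N)) :=
    (isoModFdim B).Q_inverts _ (hf.isoModFdim_unit N)
  have hc (M : GrMod A) : IsIso ((isoModFdim A).Q.map (f.counit.app M)) :=
    (isoModFdim A).Q_inverts _ (hf.isoModFdim_counit M)
  let R := Localization.Construction.lift _ hres
  let C := Localization.Construction.lift _ hcoind
  have hu' : IsIso (Functor.whiskerRight f.unit (isoModFdim B).Q) :=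
    (NatTrans.isIso_iff_isIso_app _).mpr hu
  have hc' : IsIso (Functor.whiskerRight f.counit (isoModFdim A).Q) :=
    (NatTrans.isIso_iff_isIso_app _).mpr hc
  let facR : (isoModFdim B).Q ⋙ R ≅ f.res ⋙ (isoModFdim A).Q :=
    eqToIso (Localization.Construction.fac _ hres)
  let facC : (isoModFdim A).Q ⋙ C ≅ f.coind ⋙ (isoModFdim B).Q :=
    eqToIso (Localization.Construction.fac _ hcoind)
  let α : (f.res ⋙ (isoModFdim A).Q) ⋙ C ≅ (isoModFdim B).Q :=
    Functor.associator _ _ _ ≪≫ Functor.isoWhiskerLeft f.res facC ≪≫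
      (Functor.associator _ _ _).symm ≪≫
      (asIso (Functor.whiskerRight f.unit (isoModFdim B).Q)).symm ≪≫ Functor.leftUnitor _
  let β : (f.coind ⋙ (isoModFdim B).Q) ⋙ R ≅ (isoModFdim A).Q :=
    Functor.associator _ _ _ ≪≫ Functor.isoWhiskerLeft f.coind facR ≪≫
      (Functor.associator _ _ _).symm ≪≫
      asIso (Functor.whiskerRight f.counit (isoModFdim A).Q) ≪≫ Functor.leftUnitor _
  let F := Localization.equivalence (isoModFdim B).Q (isoModFdim B)
    (isoModFdim A).Q (isoModFdim A) (f.res ⋙ (isoModFdim A).Q) R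
    (f.coind ⋙ (isoModFdim B).Q) C α β
  let sh (A : GradedAlg k) : (isoModFdim A).Localization ⥤ (isoModFdim A).Localization :=
    QGr.shift A
  let facS (A : GradedAlg k) : (isoModFdim A).Q ⋙ sh A ≅ GrMod.shift A ⋙ (isoModFdim A).Q :=
    eqToIso (Localization.Construction.fac _ (QGr.shift_inverts A))
  refine ⟨F, ⟨?_⟩⟩
  -- By the universal property of the localization, the two composites need only be compared after
  -- `Q`, where the claim is that restriction commutes with the shift of graded modules.
  let γ : (isoModFdim B).Q ⋙ (sh B ⋙ R) ≅
      (isoModFdim B).Q ⋙ (R ⋙ sh A) :=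
    (Functor.associator _ _ _).symm ≪≫ Functor.isoWhiskerRight (facS B) R ≪≫
      Functor.associator _ _ _ ≪≫ Functor.isoWhiskerLeft (GrMod.shift B) facR ≪≫
      (Functor.associator _ _ _).symm ≪≫ Functor.isoWhiskerRight f.resShift _ ≪≫
      Functor.associator _ _ _ ≪≫ Functor.isoWhiskerLeft f.res (facS A).symm ≪≫
      (Functor.associator _ _ _).symm ≪≫ Functor.isoWhiskerRight facR.symm _ ≪≫
      Functor.associator _ _ _
  exact Localization.liftNatIso (isoModFdim B).Q (isoModFdim B) _ _
    (sh B ⋙ R)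
    (R ⋙ sh A) γ

end GrNUHom.IsTailEquiv

/-! ### Path algebras and their monomial quotients as graded algebras -/

/-- A multiplicative family of submodules whose sum is direct makes an algebra graded. -/
@[reducible]
def gradedAlgebraOfIsInternal {R : Type*} [Ring R] [Algebra k R] (𝒜 : ℕ → Submodule k R)
    (one_mem : (1 : R) ∈ 𝒜 0) (mul_mem : ∀ {i j : ℕ} {a b : R}, a ∈ 𝒜 i → b ∈ 𝒜 j →
      a * b ∈ 𝒜 (i + j)) (h : DirectSum.IsInternal 𝒜) : GradedAlgebra 𝒜 :=
  { h.chooseDecomposition with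
    one_mem := one_mem
    mul_mem := fun _ _ _ _ ha hb => mul_mem ha hb }

/-- The arrows of a quiver, bundled with their endpoints. -/
abbrev ArrowOf (V : Type) [Quiver.{0} V] : Type := Σ v w : V, (v ⟶ w)

/-! ### Words of arrows and degrees of paths -/

section Word

variable {V : Type} [Quiver.{0} V]

/-- The list of the arrows of a path. -/
def word {u : V} : ∀ {v : V}, Quiver.Path u v → List (ArrowOf V)
  | _, Quiver.Path.nil => []
  | _, Quiver.Path.cons p e => word p ++ [⟨_, _, e⟩]

@[simp] theorem word_nil (v : V) : word (Quiver.Path.nil : Quiver.Path v v) = [] := rfl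

@[simp] theorem word_cons {u v w : V} (p : Quiver.Path u v) (e : v ⟶ w) :
    word (p.cons e) = word p ++ [⟨v, w, e⟩] := rfl

@[simp] theorem word_comp {u v w : V} (p : Quiver.Path u v) (q : Quiver.Path v w) :
    word (p.comp q) = word p ++ word q := by
  induction q with
  | nil => simp
  | cons q e ih => simp [ih]

/-- The common source is essential: all trivial paths have the empty word. -/
theorem word_injective {u v v' : V} (p : Quiver.Path u v) (q : Quiver.Path u v')
    (h : word p = word q) :
    (⟨u, v, p⟩ : PathOf V) = ⟨u, v', q⟩ := by
  induction p generalizing v' with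
  | nil =>
    cases q with
    | nil => rfl
    | cons q e => simp at h
  | cons p e ih =>
    cases q with
    | nil => simp at h
    | cons q e' =>
      simp only [word_cons] at h
      obtain ⟨h1, h2⟩ := List.append_inj' h rfl
      have h3 := ih q h1
      simp only [List.cons.injEq, and_true] at h2
      cases h2
      cases h3
      rfl

@[simp] theorem pathDeg_nil (Q : WeightedQuiver) (v : Q.V) :
    Q.pathDeg ⟨v, v, Quiver.Path.nil⟩ = 0 :=
  Quiver.Path.addWeight_nil _ _

@[simp] theorem pathDeg_cons (Q : WeightedQuiver) {u v w : Q.V} (p : Quiver.Path u v)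
    (e : v ⟶ w) : Q.pathDeg ⟨u, w, p.cons e⟩ = Q.pathDeg ⟨u, v, p⟩ + Q.deg e :=
  Quiver.Path.addWeight_cons _ _ _

theorem pathDeg_eq_sum (Q : WeightedQuiver) {u v : Q.V} (p : Quiver.Path u v) :
    Q.pathDeg ⟨u, v, p⟩ = ((word p).map fun e => Q.deg e.2.2).sum := by
  induction p with
  | nil => simp
  | cons p e ih => simp [ih]

theorem length_le_sum {E : Type*} (d : E → ℕ) (hd : ∀ a, 1 ≤ d a) (w : List E) :
    w.length ≤ (w.map d).sum := by
  induction w with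
  | nil => simp
  | cons a w ih =>
    have := hd a
    simp only [List.length_cons, List.map_cons, List.sum_cons]
    omega

/-- Arrows have degree at least 1, so the length of a path is at most its degree; a path is
determined by its source and its word in a finite alphabet. -/
theorem finite_pathDeg_eq (Q : WeightedQuiver) (n : ℕ) : {p | Q.pathDeg p = n}.Finite := by
  let g : PathOf Q.V → Q.V × List (ArrowOf Q.V) := fun p => (p.1, word p.2.2)
  have hg : Function.Injective g := by
    rintro ⟨u, v, p⟩ ⟨u', v', q⟩ h
    obtain ⟨rfl, h2⟩ := Prod.mk.inj h
    exact word_injective p q h2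
  refine Set.Finite.subset (Set.Finite.preimage hg.injOn
    (Set.finite_univ.prod (List.finite_length_le (ArrowOf Q.V) n))) ?_
  rintro ⟨u, v, p⟩ hp
  refine ⟨trivial, ?_⟩
  change (word p).length ≤ n
  have hp' : Q.pathDeg ⟨u, v, p⟩ = n := hp
  rw [pathDeg_eq_sum] at hp'
  exact hp' ▸ length_le_sum (fun e : ArrowOf Q.V => Q.deg e.2.2) (fun e => Q.one_le_deg e.2.2) _

end Word

/-! ### The grading and the universal property of a path algebra -/

namespace PathAlgebra

section

variable {V : Type} [Quiver.{0} V]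

theorem mem_span_ofPath_iff {s : Set (PathOf V)} {x : PathAlgebra k V} :
    x ∈ Submodule.span k (ofPath '' s) ↔ ∀ p, basis.coord p x ≠ 0 → p ∈ s := by
  refine (basis.mem_span_image (m := x) (s := s)).trans ⟨fun h p hp => h ?_, fun h p hp => h p ?_⟩
  · exact Finsupp.mem_support_iff.mpr hp
  · exact Finsupp.mem_support_iff.mp hp

theorem coord_ofPath_self (p : PathOf V) : basis.coord p (ofPath p : PathAlgebra k V) = 1 := by
  simp [ofPath]

theorem coord_ofPath_of_ne {p q : PathOf V} (h : q ≠ p) :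
    basis.coord p (ofPath q : PathAlgebra k V) = 0 := by
  simp [ofPath, h]

theorem span_range_ofPath : Submodule.span k (Set.range (ofPath : _ → PathAlgebra k V)) = ⊤ :=
  basis.span_eq

@[elab_as_elim]
theorem induction_ofPath {motive : PathAlgebra k V → Prop} (x : PathAlgebra k V)
    (ofPath : ∀ {u v : V} (p : Quiver.Path u v), motive (ofPath ⟨u, v, p⟩)) (zero : motive 0)
    (add : ∀ x y, motive x → motive y → motive (x + y))
    (smul : ∀ (c : k) x, motive x → motive (c • x)) : motive x := by
  have hx : x ∈ Submodule.span k (Set.range (PathAlgebra.ofPath : _ → PathAlgebra k V)) := by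
    rw [span_range_ofPath]; trivial
  induction hx using Submodule.span_induction with
  | mem x hx => obtain ⟨⟨u, v, p⟩, rfl⟩ := hx; exact ofPath p
  | zero => exact zero
  | add x y _ _ hx hy => exact add x y hx hy
  | smul c x _ hx => exact smul c x hx

end

theorem ofPath_mem_grading (Q : WeightedQuiver) (p : PathOf Q.V) :
    (ofPath p : PathAlgebra k Q.V) ∈ grading k Q (Q.pathDeg p) :=
  Submodule.subset_span ⟨p, rfl, rfl⟩

theorem pathDeg_comp (Q : WeightedQuiver) {u v w : Q.V} (p : Quiver.Path u v)
    (q : Quiver.Path v w) :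
    Q.pathDeg ⟨u, w, p.comp q⟩ = Q.pathDeg ⟨u, v, p⟩ + Q.pathDeg ⟨v, w, q⟩ :=
  Quiver.Path.addWeight_comp _ p q

theorem iSup_grading (Q : WeightedQuiver) : ⨆ n, grading k Q n = ⊤ := by
  rw [eq_top_iff, ← span_range_ofPath, Submodule.span_le]
  rintro _ ⟨p, rfl⟩
  exact Submodule.mem_iSup_of_mem _ (ofPath_mem_grading Q p)

theorem one_mem_grading (Q : WeightedQuiver) : (1 : PathAlgebra k Q.V) ∈ grading k Q 0 := by
  rw [one_def]
  refine Submodule.sum_mem _ fun v _ => ?_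
  have := ofPath_mem_grading (k := k) Q ⟨v, v, Quiver.Path.nil⟩
  rwa [pathDeg_nil] at this

theorem mul_mem_grading (Q : WeightedQuiver) {i j : ℕ} {a b : PathAlgebra k Q.V}
    (ha : a ∈ grading k Q i) (hb : b ∈ grading k Q j) : a * b ∈ grading k Q (i + j) := by
  induction ha using Submodule.span_induction with
  | mem a ha =>
    obtain ⟨⟨u, v, p⟩, hp, rfl⟩ := ha
    induction hb using Submodule.span_induction with
    | mem b hb =>
      obtain ⟨⟨u', v', q⟩, hq, rfl⟩ := hb
      by_cases h : v = u'
      · subst h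
        rw [ofPath_mul_of_eq, ← show _ = i from hp, ← show _ = j from hq, ← pathDeg_comp]
        exact ofPath_mem_grading Q _
      · rw [ofPath_mul_of_ne h]
        exact Submodule.zero_mem _
    | zero => rw [mul_zero]; exact Submodule.zero_mem _
    | add x y _ _ hx hy => rw [mul_add]; exact Submodule.add_mem _ hx hy
    | smul c x _ hx => rw [mul_smul_comm]; exact Submodule.smul_mem _ c hx
  | zero => rw [zero_mul]; exact Submodule.zero_mem _
  | add x y _ _ hx hy => rw [add_mul]; exact Submodule.add_mem _ hx hy
  | smul c x _ hx => rw [smul_mul_assoc]; exact Submodule.smul_mem _ c hx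

theorem coord_eq_zero_of_mem_grading (Q : WeightedQuiver) {n : ℕ} {x : PathAlgebra k Q.V}
    (hx : x ∈ grading k Q n) {p : PathOf Q.V} (hp : Q.pathDeg p ≠ n) : basis.coord p x = 0 := by
  by_contra h
  exact hp (mem_span_ofPath_iff.mp hx p h)

theorem isInternal_grading (Q : WeightedQuiver) : DirectSum.IsInternal (grading k Q) := by
  refine isInternal_of_separated (N := k) _ (iSup_grading Q) fun i x hx hne => ?_
  obtain ⟨p, hp⟩ : ∃ p, basis.coord p x ≠ 0 := by
    by_contra! h
    exact hne (basis.forall_coord_eq_zero_iff.mp h)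
  have hpi : Q.pathDeg p = i := by
    by_contra h
    exact hp (coord_eq_zero_of_mem_grading Q hx h)
  exact ⟨basis.coord p, fun j hj y hy => coord_eq_zero_of_mem_grading Q hy (hpi ▸ hj.symm), hp⟩

instance (Q : WeightedQuiver) : GradedAlgebra (grading k Q) :=
  gradedAlgebraOfIsInternal _ (one_mem_grading Q) (mul_mem_grading Q) (isInternal_grading Q)

theorem finite_grading (Q : WeightedQuiver) (n : ℕ) : Module.Finite k (grading k Q n) :=
  Module.Finite.span_of_finite k ((finite_pathDeg_eq Q n).image _)

section Lift

variable {V : Type} [Quiver.{0} V] [Fintype V] {R : Type*} [Ring R] [Algebra k R]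

/-- The homomorphism, not necessarily preserving the unit, given by a map on paths that is
compatible with products. -/
def lift (F : PathOf V → R)
    (hF : ∀ {u v w : V} (p : Quiver.Path u v) (q : Quiver.Path v w),
      F ⟨u, w, p.comp q⟩ = F ⟨u, v, p⟩ * F ⟨v, w, q⟩)
    (hF' : ∀ p q : PathOf V, p.2.1 ≠ q.1 → F p * F q = 0) : PathAlgebra k V →ₙₐ[k] R :=
  { (basis.constr k F : PathAlgebra k V →ₗ[k] R) with
    map_zero' := map_zero _
    map_mul' := fun x y => by
      change basis.constr k F (x * y) = basis.constr k F x * basis.constr k F y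
      have hb : ∀ p, basis.constr k F (ofPath p : PathAlgebra k V) = F p := fun p =>
        basis.constr_basis k F p
      induction x using induction_ofPath with
      | ofPath p =>
        rename_i u v
        induction y using induction_ofPath with
        | ofPath q =>
          rename_i u' v'
          rw [hb, hb]
          by_cases h : v = u'
          · subst h
            rw [ofPath_mul_of_eq, hb, hF]
          · rw [ofPath_mul_of_ne h, map_zero, hF' _ _ h]
        | zero => simp
        | add x y hx hy => rw [mul_add, map_add, map_add, hx, hy, mul_add]
        | smul c x hx => rw [mul_smul_comm, map_smul, map_smul, hx, mul_smul_comm]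
      | zero => simp
      | add x y hx hy => rw [add_mul, map_add, map_add, hx, hy, add_mul]
      | smul c x hx => rw [smul_mul_assoc, map_smul, map_smul, hx, smul_mul_assoc] }

@[simp] theorem lift_ofPath (F : PathOf V → R) (hF hF') (p : PathOf V) :
    lift (k := k) F hF hF' (ofPath p) = F p :=
  basis.constr_basis k F p

end Lift

end PathAlgebra

/-! ### Monomial ideals and their quotients -/

section MonomialAlgebra

open PathAlgebra

variable {Q : WeightedQuiver} {S : Set (PathOf Q.V)}

theorem k_smul_mem (I : TwoSidedIdeal (PathAlgebra k Q.V)) (c : k) {x : PathAlgebra k Q.V}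
    (hx : x ∈ I) : c • x ∈ I := by
  rw [← one_mul x, ← smul_mul_assoc]
  exact I.mul_mem_left _ _ hx

theorem span_le_of_forall_mem (I : TwoSidedIdeal (PathAlgebra k Q.V))
    {s : Set (PathAlgebra k Q.V)} (h : ∀ x ∈ s, x ∈ I) {x : PathAlgebra k Q.V}
    (hx : x ∈ Submodule.span k s) : x ∈ I := by
  induction hx using Submodule.span_induction with
  | mem x hx => exact h x hx
  | zero => exact I.zero_mem
  | add x y _ _ hx hy => exact I.add_mem hx hy
  | smul c x _ hx => exact k_smul_mem I c hx

/-- The ideal generated by a set of paths is contained in the span of any set of paths that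
contains the generators and is closed under multiplication by paths. -/
theorem mem_span_of_mem_monomialIdeal (P : PathOf Q.V → Prop) (hS : ∀ p ∈ S, P p)
    (hr : ∀ {u v w : Q.V} (p : Quiver.Path u v) (q : Quiver.Path v w), P ⟨u, v, p⟩ →
      P ⟨u, w, p.comp q⟩)
    (hl : ∀ {u v w : Q.V} (p : Quiver.Path u v) (q : Quiver.Path v w), P ⟨v, w, q⟩ →
      P ⟨u, w, p.comp q⟩) {x : PathAlgebra k Q.V} (hx : x ∈ monomialIdeal k Q S) :
    x ∈ Submodule.span k (ofPath '' {p | P p}) := by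
  induction hx using TwoSidedIdeal.span_induction with
  | mem x hx =>
    obtain ⟨p, hp, rfl⟩ := hx
    exact Submodule.subset_span ⟨p, hS p hp, rfl⟩
  | zero => exact Submodule.zero_mem _
  | add x y _ _ hx hy => exact Submodule.add_mem _ hx hy
  | neg x _ hx => exact Submodule.neg_mem _ hx
  | left_absorb a x hx' hx =>
    clear hx'
    induction a using induction_ofPath with
    | ofPath q =>
      rename_i u v
      induction hx using Submodule.span_induction with
      | mem x hx =>
        obtain ⟨⟨u', v', p⟩, hp, rfl⟩ := hx
        by_cases h : v = u'
        · subst h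
          rw [ofPath_mul_of_eq]
          exact Submodule.subset_span ⟨_, hl q p hp, rfl⟩
        · rw [ofPath_mul_of_ne h]; exact Submodule.zero_mem _
      | zero => rw [mul_zero]; exact Submodule.zero_mem _
      | add x y _ _ hx hy => rw [mul_add]; exact Submodule.add_mem _ hx hy
      | smul c x _ hx => rw [mul_smul_comm]; exact Submodule.smul_mem _ c hx
    | zero => rw [zero_mul]; exact Submodule.zero_mem _
    | add a b ha hb => rw [add_mul]; exact Submodule.add_mem _ ha hb
    | smul c a ha => rw [smul_mul_assoc]; exact Submodule.smul_mem _ c ha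
  | right_absorb a x hx' hx =>
    clear hx'
    induction a using induction_ofPath with
    | ofPath q =>
      rename_i u v
      induction hx using Submodule.span_induction with
      | mem x hx =>
        obtain ⟨⟨u', v', p⟩, hp, rfl⟩ := hx
        by_cases h : v' = u
        · subst h
          rw [ofPath_mul_of_eq]
          exact Submodule.subset_span ⟨_, hr p q hp, rfl⟩
        · rw [ofPath_mul_of_ne h]; exact Submodule.zero_mem _
      | zero => rw [zero_mul]; exact Submodule.zero_mem _
      | add x y _ _ hx hy => rw [add_mul]; exact Submodule.add_mem _ hx hy
      | smul c x _ hx => rw [smul_mul_assoc]; exact Submodule.smul_mem _ c hx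
    | zero => rw [mul_zero]; exact Submodule.zero_mem _
    | add a b ha hb => rw [mul_add]; exact Submodule.add_mem _ ha hb
    | smul c a ha => rw [mul_smul_comm]; exact Submodule.smul_mem _ c ha

/-- The ideal generated by a set of paths is spanned by the paths it contains. -/
theorem mem_monomialIdeal_iff {x : PathAlgebra k Q.V} :
    x ∈ monomialIdeal k Q S ↔
      ∀ p, basis.coord p x ≠ 0 → (ofPath p : PathAlgebra k Q.V) ∈ monomialIdeal k Q S := by
  constructor
  · intro hx
    refine mem_span_ofPath_iff.mp (mem_span_of_mem_monomialIdeal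
      (fun p => (ofPath p : PathAlgebra k Q.V) ∈ monomialIdeal k Q S) ?_ ?_ ?_ hx)
    · intro p hp
      exact TwoSidedIdeal.subset_span ⟨p, hp, rfl⟩
    · intro u v w p q hp
      rw [← ofPath_mul_of_eq]
      exact TwoSidedIdeal.mul_mem_right _ _ _ hp
    · intro u v w p q hq
      rw [← ofPath_mul_of_eq]
      exact TwoSidedIdeal.mul_mem_left _ _ _ hq
  · intro h
    refine span_le_of_forall_mem _ (s := ofPath ''
      {p | (ofPath p : PathAlgebra k Q.V) ∈ monomialIdeal k Q S}) ?_ (mem_span_ofPath_iff.mpr h)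
    rintro _ ⟨p, hp, rfl⟩
    exact hp

namespace MonomialAlgebra

variable (k Q S) in
/-- The quotient map from the path algebra. -/
def mk : PathAlgebra k Q.V →ₐ[k] MonomialAlgebra k Q S := (monomialIdeal k Q S).ringCon.mkₐ k

theorem mk_surjective : Function.Surjective (mk k Q S) := RingCon.mkₐ_surjective _

theorem mk_eq_zero_iff {x : PathAlgebra k Q.V} : mk k Q S x = 0 ↔ x ∈ monomialIdeal k Q S :=
  RingCon.eq _

theorem isInternal_grading : DirectSum.IsInternal (grading k Q S) := by
  have hsup : ⨆ n, grading k Q S n = ⊤ := by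
    change ⨆ n, (PathAlgebra.grading k Q n).map (mk k Q S).toLinearMap = ⊤
    rw [← Submodule.map_iSup, PathAlgebra.iSup_grading, Submodule.map_top, LinearMap.range_eq_top]
    exact mk_surjective
  refine isInternal_of_separated (N := k) _ hsup fun i a ha hne => ?_
  obtain ⟨x, hx, rfl⟩ := ha
  -- An element outside a monomial ideal involves some path outside it. The coordinate along that
  -- path vanishes on the ideal, so it descends to the quotient and serves as the separating
  -- functional.
  obtain ⟨p, hp, hpI⟩ : ∃ p, basis.coord p x ≠ 0 ∧
      (ofPath p : PathAlgebra k Q.V) ∉ monomialIdeal k Q S := by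
    by_contra! h
    exact hne (mk_eq_zero_iff.mpr (mem_monomialIdeal_iff.mpr h))
  have hpi : Q.pathDeg p = i := by
    by_contra h
    exact hp (coord_eq_zero_of_mem_grading Q hx h)
  have hker : ∀ y, mk k Q S y = 0 → basis.coord p y = 0 := fun y hy => by
    by_contra h
    exact hpI (mem_monomialIdeal_iff.mp (mk_eq_zero_iff.mp hy) p h)
  let φ : MonomialAlgebra k Q S →ₗ[k] k :=
    { toFun := fun a => basis.coord p (Function.surjInv mk_surjective a)
      map_add' := fun a b => by
        rw [← map_add, ← sub_eq_zero, ← map_sub]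
        apply hker
        simp [Function.surjInv_eq]
      map_smul' := fun c a => by
        rw [RingHom.id_apply, ← map_smul, ← sub_eq_zero, ← map_sub]
        apply hker
        rw [map_sub, map_smul]
        simp [Function.surjInv_eq] }
  have hφ : ∀ y, φ (mk k Q S y) = basis.coord p y := fun y => by
    change basis.coord p _ = _
    rw [← sub_eq_zero, ← map_sub]
    apply hker
    exact (map_sub _ _ _).trans (sub_eq_zero.mpr (Function.surjInv_eq mk_surjective _))
  refine ⟨φ, ?_, ?_⟩
  · rintro j hj _ ⟨y, hy, rfl⟩
    exact (hφ y).trans (coord_eq_zero_of_mem_grading Q hy (hpi ▸ hj.symm))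
  · exact fun h => hp ((hφ x).symm.trans h)

instance : GradedAlgebra (grading k Q S) :=
  gradedAlgebraOfIsInternal _ ⟨1, PathAlgebra.one_mem_grading Q, map_one (mk k Q S)⟩
    (by
      rintro i j _ _ ⟨x, hx, rfl⟩ ⟨y, hy, rfl⟩
      exact ⟨x * y, mul_mem_grading Q hx hy, map_mul (mk k Q S) x y⟩)
    isInternal_grading

theorem finite_grading (n : ℕ) : Module.Finite k (grading k Q S n) :=
  have := PathAlgebra.finite_grading (k := k) Q n
  Module.Finite.map _ _

theorem map_eq_of_mk_eq {R : Type*} [Ring R] [Algebra k R] (g : PathAlgebra k Q.V →ₙₐ[k] R)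
    (hg : ∀ p ∈ S, g (ofPath p) = 0) {x y : PathAlgebra k Q.V}
    (h : mk k Q S x = mk k Q S y) : g x = g y := by
  have hI : monomialIdeal k Q S ≤ TwoSidedIdeal.ker g := by
    rw [monomialIdeal, TwoSidedIdeal.span_le]
    rintro _ ⟨p, hp, rfl⟩
    exact (TwoSidedIdeal.mem_ker g).mpr (hg p hp)
  rw [← sub_eq_zero, ← map_sub]
  exact (TwoSidedIdeal.mem_ker g).mp (hI (mk_eq_zero_iff.mp (by rw [map_sub, h, sub_self])))

/-- A homomorphism, not necessarily preserving the unit, that vanishes on the relations descends to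
the monomial algebra. -/
def lift {R : Type*} [Ring R] [Algebra k R] (g : PathAlgebra k Q.V →ₙₐ[k] R)
    (hg : ∀ p ∈ S, g (ofPath p) = 0) : MonomialAlgebra k Q S →ₙₐ[k] R where
  toFun a := g (Function.surjInv mk_surjective a)
  map_smul' c a := by
    rw [MonoidHom.id_apply, ← map_smul]
    exact map_eq_of_mk_eq g hg (by rw [map_smul]; simp [Function.surjInv_eq])
  map_zero' := by
    rw [← map_zero g]
    exact map_eq_of_mk_eq g hg (by simp [Function.surjInv_eq])
  map_add' a b := by
    rw [← map_add]
    exact map_eq_of_mk_eq g hg (by simp [Function.surjInv_eq])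
  map_mul' a b := by
    rw [← map_mul]
    exact map_eq_of_mk_eq g hg (by simp [Function.surjInv_eq])

theorem lift_mk {R : Type*} [Ring R] [Algebra k R] (g : PathAlgebra k Q.V →ₙₐ[k] R)
    (hg : ∀ p ∈ S, g (ofPath p) = 0) (x : PathAlgebra k Q.V) :
    lift g hg (mk k Q S x) = g x :=
  map_eq_of_mk_eq g hg (Function.surjInv_eq mk_surjective _)

end MonomialAlgebra

end MonomialAlgebra

variable (k) in
/-- The path algebra of a weighted quiver as a graded algebra. -/
def pathGradedAlg (Q : WeightedQuiver) : GradedAlg k where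
  carrier := PathAlgebra k Q.V
  grading := PathAlgebra.grading k Q

variable (k) in
/-- A monomial algebra as a graded algebra. -/
def monomialGradedAlg (Q : WeightedQuiver) (S : Set (PathOf Q.V)) : GradedAlg k where
  carrier := MonomialAlgebra k Q S
  grading := MonomialAlgebra.grading k Q S

theorem isPathAlgebraOf_pathGradedAlg (Q : WeightedQuiver) :
    (pathGradedAlg k Q).IsPathAlgebraOf Q :=
  ⟨AlgEquiv.refl, fun _ => Submodule.map_id _⟩

theorem isMonomialAlgebraOf_monomialGradedAlg (Q : WeightedQuiver) (S : Set (PathOf Q.V)) :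
    (monomialGradedAlg k Q S).IsMonomialAlgebraOf Q S :=
  ⟨AlgEquiv.refl, fun _ => Submodule.map_id _⟩

/-! ### Quivers with one vertex -/

/-- The vertex of the quiver with one vertex and set of arrows `E`. -/
def BouquetVertex (_ : Type) : Type := Unit

namespace BouquetVertex

variable {E : Type}

instance : Quiver.{0} (BouquetVertex E) := ⟨fun _ _ => E⟩
instance : Unique (BouquetVertex E) := inferInstanceAs (Unique Unit)
instance : Fintype (BouquetVertex E) := inferInstanceAs (Fintype Unit)

/-- The path consisting of the letters of a word. -/
def path : List E → Quiver.Path (default : BouquetVertex E) default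
  | [] => Quiver.Path.nil
  | a :: w => (Quiver.Hom.toPath (V := BouquetVertex E) (a := default) (b := default) a).comp
      (path w)

/-- The path consisting of the letters of a word, bundled with its endpoints. -/
def pathOf (w : List E) : PathOf (BouquetVertex E) := ⟨default, default, path w⟩

/-- The letters of a path. -/
def letters (p : PathOf (BouquetVertex E)) : List E := (word p.2.2).map fun e => e.2.2

theorem path_append (u v : List E) : path (u ++ v) = (path u).comp (path v) := by
  induction u with
  | nil => exact (Quiver.Path.nil_comp _).symm
  | cons a u ih =>
    change Quiver.Path.comp _ (path (u ++ v)) = _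
    rw [ih, ← Quiver.Path.comp_assoc]
    rfl

theorem letters_pathOf (w : List E) : letters (pathOf w) = w := by
  induction w with
  | nil => rfl
  | cons a w ih =>
    refine (congrArg (List.map _) (word_comp (Quiver.Hom.toPath (V := BouquetVertex E)
      (a := default) (b := default) a) (path w))).trans ?_
    exact congrArg (a :: ·) ih

theorem pathOf_letters (p : PathOf (BouquetVertex E)) : pathOf (letters p) = p := by
  obtain ⟨u, v, p⟩ := p
  obtain rfl : u = default := Subsingleton.elim _ _
  obtain rfl : v = default := Subsingleton.elim _ _
  have : ∀ {v : BouquetVertex E} (p : Quiver.Path (default : BouquetVertex E) v),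
      pathOf (letters ⟨default, v, p⟩) = ⟨default, v, p⟩ := by
    intro v p
    induction p with
    | nil => rfl
    | cons p e ih =>
      rename_i b c
      obtain rfl : b = default := Subsingleton.elim _ _
      obtain rfl : c = default := Subsingleton.elim _ _
      have h1 : letters ⟨default, default, p.cons e⟩ = letters ⟨default, default, p⟩ ++ [e] := by
        simp [letters]
      have h2 : path (letters ⟨default, default, p⟩) = p := by
        simpa [pathOf] using ih
      rw [h1]
      change (⟨default, default, path (_ ++ [e])⟩ : PathOf (BouquetVertex E)) = _
      rw [path_append, h2]
      rfl
  exact this p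

theorem pathOf_injective : Function.Injective (pathOf : List E → _) :=
  Function.LeftInverse.injective letters_pathOf

end BouquetVertex

/-- The quiver with one vertex and with a given weighted set of arrows. -/
abbrev bouquet (E : Type) [Finite E] (d : E → ℕ) (hd : ∀ a, 1 ≤ d a) : WeightedQuiver where
  V := BouquetVertex E
  finiteArrows _ _ := inferInstanceAs (Finite E)
  deg a := d a
  one_le_deg a := hd a

/-- The degree of a word in weighted letters. -/
def wordDeg {E : Type} (d : E → ℕ) (w : List E) : ℕ := (w.map d).sum

section WordDeg

variable {E : Type} (d : E → ℕ)

@[simp] theorem wordDeg_nil : wordDeg d [] = 0 := rfl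
@[simp] theorem wordDeg_cons (a : E) (w : List E) :
    wordDeg d (a :: w) = d a + wordDeg d w := by simp [wordDeg]
@[simp] theorem wordDeg_append (u v : List E) :
    wordDeg d (u ++ v) = wordDeg d u + wordDeg d v := by simp [wordDeg]

/-- Letters are added to the prefix until its degree reaches `n`; the last one overshoots by at most
`D`. -/
theorem exists_split_word {D : ℕ} (hD : ∀ a, d a ≤ D) (w : List E) (n : ℕ)
    (hn : n ≤ wordDeg d w) :
    ∃ u v, w = u ++ v ∧ n ≤ wordDeg d u ∧ wordDeg d u ≤ n + D := by
  induction w generalizing n with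
  | nil => exact ⟨[], [], rfl, hn, by simp⟩
  | cons a w ih =>
    have ha := hD a
    by_cases h : n = 0
    · exact ⟨[], a :: w, rfl, by simp [h], by simp⟩
    · obtain ⟨u, v, rfl, h1, h2⟩ := ih (n - d a) (by rw [wordDeg_cons] at hn; omega)
      by_cases h' : n ≤ d a
      · exact ⟨[a], u ++ v, rfl, by simpa using h', by simp; omega⟩
      · exact ⟨a :: u, v, rfl, by rw [wordDeg_cons]; omega, by rw [wordDeg_cons]; omega⟩

end WordDeg

namespace PathAlgebra

open BouquetVertex

variable {E : Type}

variable (k) in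
/-- The monomial given by a word. -/
def monomial (w : List E) : PathAlgebra k (BouquetVertex E) := ofPath (pathOf w)

theorem monomial_nil : monomial k ([] : List E) = 1 := by
  rw [one_def]
  exact (Fintype.sum_unique (fun v : BouquetVertex E =>
    (ofPath ⟨v, v, Quiver.Path.nil⟩ : PathAlgebra k (BouquetVertex E)))).symm

theorem monomial_append (u v : List E) :
    monomial k (u ++ v) = monomial k u * monomial k v := by
  change (ofPath ⟨_, _, path (u ++ v)⟩ : PathAlgebra k (BouquetVertex E)) = _
  rw [path_append, ← ofPath_mul_of_eq]
  rfl

theorem pathDeg_pathOf [Finite E] (d : E → ℕ) (hd : ∀ a, 1 ≤ d a) (w : List E) :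
    (bouquet E d hd).pathDeg (pathOf w) = wordDeg d w := by
  conv_rhs => rw [← letters_pathOf w]
  refine (pathDeg_eq_sum (bouquet E d hd) (path w)).trans ?_
  rw [wordDeg, letters, List.map_map]
  rfl

theorem grading_bouquet [Finite E] (d : E → ℕ) (hd : ∀ a, 1 ≤ d a) (n : ℕ) :
    grading k (bouquet E d hd) n = Submodule.span k (monomial k '' {w | wordDeg d w = n}) := by
  unfold grading
  congr 1
  ext x
  constructor
  · rintro ⟨p, hp, rfl⟩
    refine ⟨letters p, ?_, ?_⟩
    · rw [← pathOf_letters p] at hp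
      exact (pathDeg_pathOf d hd _).symm.trans hp
    · exact congrArg ofPath (pathOf_letters p)
  · rintro ⟨w, hw, rfl⟩
    exact ⟨pathOf w, (pathDeg_pathOf d hd _).trans hw, rfl⟩

theorem lhom_ext_monomial {M : Type*} [AddCommGroup M] [Module k M]
    {f g : PathAlgebra k (BouquetVertex E) →ₗ[k] M}
    (h : ∀ w, f (monomial k w) = g (monomial k w)) : f = g :=
  lhom_ext fun p => by rw [← pathOf_letters p]; exact h _

section Lift

variable {R : Type*} [Ring R] [Algebra k R]

variable (k) in
/-- The homomorphism determined by the images of the letters and of the unit. -/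
def bouquetLift (e : R) (x : E → R) (he : e * e = e) (hx : ∀ a, x a * e = x a) :
    PathAlgebra k (BouquetVertex E) →ₙₐ[k] R :=
  -- The factor `e` between the images of two consecutive words can be dropped, since each letter
  -- absorbs `e` on its right and `e` is idempotent. This gives multiplicativity.
  have hprod : ∀ w : List E, e * (w.map x).prod * e = e * (w.map x).prod := by
    intro w
    induction w using List.reverseRecOn with
    | nil => simp [he]
    | append_singleton w a _ => simp [mul_assoc, hx]
  lift (fun p => e * ((letters p).map x).prod)
    (fun p q => by
      rw [← mul_assoc, hprod, mul_assoc, ← List.prod_append, ← List.map_append]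
      simp [letters])
    (fun p q h => absurd (Subsingleton.elim _ _) h)

theorem bouquetLift_monomial (e : R) (x : E → R) (he hx) (w : List E) :
    bouquetLift k e x he hx (monomial k w) = e * (w.map x).prod := by
  unfold bouquetLift monomial
  rw [lift_ofPath, letters_pathOf]

end Lift

end PathAlgebra

/-! ### Monomial algebras in terms of forbidden words -/

section BouquetAlgebra

open PathAlgebra BouquetVertex

variable {E : Type} [Finite E] (d : E → ℕ) (hd : ∀ a, 1 ≤ d a) (F : Set (List E))

variable (k) in
/-- The monomial algebra with weighted generators `E` and relations `F`. -/
def wordAlg : GradedAlg k := monomialGradedAlg k (bouquet E d hd) (pathOf '' F)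

variable (k) in
/-- The class of a word in a monomial algebra. -/
def wordClass (w : List E) : (wordAlg k d hd F).carrier :=
  MonomialAlgebra.mk k (bouquet E d hd) (pathOf '' F) (monomial k w)

theorem wordClass_append (u v : List E) :
    wordClass k d hd F (u ++ v) = wordClass k d hd F u * wordClass k d hd F v :=
  (congrArg _ (monomial_append u v)).trans (map_mul (MonomialAlgebra.mk k (bouquet E d hd) _) _ _)

theorem wordClass_nil : wordClass k d hd F [] = 1 :=
  (congrArg _ monomial_nil).trans (map_one (MonomialAlgebra.mk k (bouquet E d hd) _))

theorem grading_wordAlg (n : ℕ) :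
    (wordAlg k d hd F).grading n =
      Submodule.span k (wordClass k d hd F '' {w | wordDeg d w = n}) := by
  change (PathAlgebra.grading k (bouquet E d hd) n).map
    (MonomialAlgebra.mk k (bouquet E d hd) (pathOf '' F)).toLinearMap = _
  rw [grading_bouquet]
  refine (Submodule.map_span _ _).trans (congrArg _ (Set.image_image _ _ _))

theorem wordClass_mem_grading (w : List E) :
    wordClass k d hd F w ∈ (wordAlg k d hd F).grading (wordDeg d w) := by
  rw [grading_wordAlg]
  exact Submodule.subset_span ⟨w, rfl, rfl⟩

theorem span_wordClass : Submodule.span k (Set.range (wordClass k d hd F)) = ⊤ := by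
  rw [Submodule.eq_top_iff']
  intro a
  induction a using GradedAlg.induction_homogeneous with
  | mem n a ha =>
    rw [grading_wordAlg] at ha
    exact Submodule.span_mono (Set.image_subset_range _ _) ha
  | zero => exact Submodule.zero_mem _
  | add a b ha hb => exact Submodule.add_mem _ ha hb

theorem locallyFinite_wordAlg : (wordAlg k d hd F).LocallyFinite :=
  fun n => MonomialAlgebra.finite_grading n

variable {F}

theorem wordClass_eq_zero {w : List E} (h : ∃ s ∈ F, s <:+: w) : wordClass k d hd F w = 0 := by
  obtain ⟨s, hs, u, v, rfl⟩ := h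
  have h0 : wordClass k d hd F s = 0 :=
    MonomialAlgebra.mk_eq_zero_iff.mpr (TwoSidedIdeal.subset_span ⟨_, ⟨s, hs, rfl⟩, rfl⟩)
  rw [wordClass_append, wordClass_append, h0, mul_zero, zero_mul]

theorem isMonomialAlgebraOf_wordAlg :
    (wordAlg k d hd F).IsMonomialAlgebraOf (bouquet E d hd) (pathOf '' F) :=
  isMonomialAlgebraOf_monomialGradedAlg _ _

theorem adjoin_wordAlg (h : ∀ a, d a = 1) :
    Algebra.adjoin k ((wordAlg k d hd F).grading 1 : Set (wordAlg k d hd F).carrier) = ⊤ := by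
  have hw : ∀ w, wordClass k d hd F w ∈
      Algebra.adjoin k ((wordAlg k d hd F).grading 1 : Set (wordAlg k d hd F).carrier) := by
    intro w
    induction w with
    | nil => rw [wordClass_nil]; exact one_mem _
    | cons a w ih =>
      rw [← List.singleton_append, wordClass_append]
      refine mul_mem (Algebra.subset_adjoin ?_) ih
      have := wordClass_mem_grading (k := k) d hd F [a]
      rwa [wordDeg_cons, wordDeg_nil, add_zero, h] at this
  rw [← Algebra.toSubmodule_eq_top, eq_top_iff, ← span_wordClass, Submodule.span_le]
  rintro _ ⟨w, rfl⟩
  exact hw w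

/-- A homomorphism out of a monomial algebra, from the images of the letters and of the unit. -/
theorem exists_hom_wordAlg (B : GradedAlg k) (e : B.carrier) (x : E → B.carrier)
    (he : e * e = e) (hx : ∀ a, x a * e = x a)
    (he₀ : e ∈ B.grading 0) (hx₀ : ∀ a, x a ∈ B.grading (d a))
    (hF : ∀ s ∈ F, e * (s.map x).prod = 0) :
    ∃ f : GrNUHom (wordAlg k d hd F) B,
      ∀ w, f (wordClass k d hd F w) = e * (w.map x).prod := by
  let f : (wordAlg k d hd F).carrier →ₙₐ[k] B.carrier :=
    MonomialAlgebra.lift (Q := bouquet E d hd) (S := pathOf '' F) (bouquetLift k e x he hx) (by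
      rintro _ ⟨s, hs, rfl⟩
      exact (bouquetLift_monomial e x he hx s).trans (hF s hs))
  have hf : ∀ w, f (wordClass k d hd F w) = e * (w.map x).prod := fun w =>
    (MonomialAlgebra.lift_mk _ _ _).trans (bouquetLift_monomial e x he hx w)
  have hdeg : ∀ w : List E, e * (w.map x).prod ∈ B.grading (wordDeg d w) := by
    intro w
    have : (w.map x).prod ∈ B.grading (wordDeg d w) := by
      induction w with
      | nil => exact GrNUHom.one_mem_grading B
      | cons a w ih =>
        rw [List.map_cons, List.prod_cons, wordDeg_cons]
        exact SetLike.mul_mem_graded (hx₀ a) ih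
    simpa using SetLike.mul_mem_graded he₀ this
  refine ⟨⟨f, fun {n a} ha => ?_⟩, hf⟩
  rw [grading_wordAlg] at ha
  induction ha using Submodule.span_induction with
  | mem a ha =>
    obtain ⟨w, hw, rfl⟩ := ha
    rw [hf, ← show _ = n from hw]
    exact hdeg w
  | zero => rw [map_zero]; exact Submodule.zero_mem _
  | add a b _ _ ha hb => rw [map_add]; exact Submodule.add_mem _ ha hb
  | smul c a _ ha => rw [map_smul]; exact Submodule.smul_mem _ c ha

end BouquetAlgebra

/-! ### Homomorphisms that are bijective in large degrees -/

section Bijective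

variable {A B : GradedAlg k} (f : GrNUHom A B) (m : ℕ)

/-- The components in large degrees of a homomorphism that is bijective there. -/
def GrNUHom.gradingEquiv (hinj : ∀ n ≥ m, ∀ a ∈ A.grading n, f a = 0 → a = 0)
    (hsurj : ∀ n ≥ m, ∀ b ∈ B.grading n, ∃ a ∈ A.grading n, f a = b) (n : ℕ) (hn : m ≤ n) :
    A.grading n ≃ₗ[k] B.grading n :=
  LinearEquiv.ofBijective
    (LinearMap.restrict (p := A.grading n) (q := B.grading n)
      (f.toHom : A.carrier →ₗ[k] B.carrier) fun _ ha => f.map_mem ha)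
    ⟨(injective_iff_map_eq_zero _).mpr fun a ha =>
        Subtype.ext (hinj n hn a a.2 (congrArg Subtype.val ha)),
      fun b => by
        obtain ⟨a, ha, hb⟩ := hsurj n hn b b.2
        exact ⟨⟨a, ha⟩, Subtype.ext hb⟩⟩

/-- The lift is `b ↦ f⁻¹(f(a) b)`, defined on each homogeneous component of `B`, because `f(a) b`
has degree at least `n ≥ m`. Its linearity over `A` follows from injectivity of `f` in those
degrees. -/
theorem GrNUHom.exists_lift_of_bijective (h1 : f 1 = 1)
    (hinj : ∀ n ≥ m, ∀ a ∈ A.grading n, f a = 0 → a = 0)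
    (hsurj : ∀ n ≥ m, ∀ b ∈ B.grading n, ∃ a ∈ A.grading n, f a = b)
    (n : ℕ) (hn : n ≥ m) (a : A.carrier) (ha : a ∈ A.grading n) :
    ∃ L : B.carrier →ₗ[k] A.carrier, L 1 = a ∧ (∀ b a', L (b * f a') = L b * a') ∧
      (∀ j, ∀ b ∈ B.grading j, L b ∈ A.grading (n + j)) ∧ ∀ b, f (L b) = f a * b * f 1 := by
  let e (j : ℕ) := f.gradingEquiv m hinj hsurj (n + j) (le_add_right hn)
  let μ (j : ℕ) : B.grading j →ₗ[k] B.grading (n + j) :=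
    LinearMap.restrict (LinearMap.mulLeft k (f a)) fun b hb =>
      SetLike.mul_mem_graded (f.map_mem ha) hb
  let L : B.carrier →ₗ[k] A.carrier :=
    (DirectSum.toModule k ℕ A.carrier fun j =>
      (A.grading (n + j)).subtype ∘ₗ (e j).symm.toLinearMap ∘ₗ μ j) ∘ₗ
      (DirectSum.decomposeLinearEquiv B.grading).toLinearMap
  have hL : ∀ j, ∀ b (hb : b ∈ B.grading j), L b = (e j).symm (μ j ⟨b, hb⟩) := by
    intro j b hb
    change DirectSum.toModule k ℕ A.carrier _ (DirectSum.decompose B.grading b) = _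
    rw [DirectSum.decompose_of_mem _ hb]
    exact DirectSum.toModule_lof k j _
  have hmem : ∀ j, ∀ b ∈ B.grading j, L b ∈ A.grading (n + j) := fun j b hb => by
    rw [hL j b hb]; exact Subtype.property _
  have hval : ∀ b, f (L b) = f a * b := by
    intro b
    induction b using GradedAlg.induction_homogeneous with
    | mem j b hb =>
      rw [hL j b hb]
      exact congrArg Subtype.val ((e j).apply_symm_apply (μ j ⟨b, hb⟩))
    | zero => simp
    | add b c hb hc => rw [map_add, map_add, hb, hc, mul_add]
  have huniq : ∀ i ≥ m, ∀ x ∈ A.grading i, ∀ y ∈ A.grading i, f x = f y → x = y :=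
    fun i hi x hx y hy h => by
      rw [← sub_eq_zero]
      exact hinj i hi _ (Submodule.sub_mem _ hx hy) (by rw [map_sub, h, sub_self])
  refine ⟨L, ?_, fun b a' => ?_, hmem, fun b => by rw [hval, h1, mul_one]⟩
  · refine huniq n hn _ ?_ _ ha (by rw [hval, mul_one])
    simpa using hmem 0 1 (GrNUHom.one_mem_grading B)
  · induction b using GradedAlg.induction_homogeneous with
    | mem j b hb =>
      induction a' using GradedAlg.induction_homogeneous with
      | mem i a' ha' =>
        refine huniq (n + (j + i)) (by omega) _ (hmem _ _ (SetLike.mul_mem_graded hb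
          (f.map_mem ha'))) _ ?_ (by rw [hval, map_mul, hval, mul_assoc])
        rw [← add_assoc]
        exact SetLike.mul_mem_graded (hmem j b hb) ha'
      | zero => simp
      | add x y hx hy => rw [map_add, mul_add, map_add, hx, hy, mul_add]
    | zero => simp
    | add x y hx hy => rw [add_mul, map_add, hx, hy, map_add, add_mul]

end Bijective

/-! ### From monomial algebras to connected monomial algebras -/

section ArrowProduct

open PathAlgebra

variable (k) {V : Type} [Quiver.{0} V]

/-- An arrow as an element of the path algebra. -/
def ofArrow (e : ArrowOf V) : PathAlgebra k V := ofPath ⟨e.1, e.2.1, e.2.2.toPath⟩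

theorem ofPath_cons {u v w : V} (p : Quiver.Path u v) (e : v ⟶ w) :
    (ofPath ⟨u, w, p.cons e⟩ : PathAlgebra k V) = ofPath ⟨u, v, p⟩ * ofArrow k ⟨v, w, e⟩ :=
  (ofPath_mul_of_eq p e.toPath).symm

variable [Fintype V]

/-- The product of a list of arrows in the path algebra. -/
def arrowProd (w : List (ArrowOf V)) : PathAlgebra k V := (w.map (ofArrow k)).prod

theorem arrowProd_append (u v : List (ArrowOf V)) :
    arrowProd k (u ++ v) = arrowProd k u * arrowProd k v := by simp [arrowProd]

theorem arrowProd_singleton (e : ArrowOf V) : arrowProd k [e] = ofArrow k e := by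
  simp [arrowProd]

/-- Trivial paths are excluded because the empty product is 1, the sum of all vertex idempotents. -/
theorem arrowProd_word {u v : V} (p : Quiver.Path u v) (hp : word p ≠ []) :
    arrowProd k (word p) = ofPath ⟨u, v, p⟩ := by
  induction p with
  | nil => exact absurd rfl hp
  | cons p e ih =>
    rw [word_cons, arrowProd_append, arrowProd_singleton, ofPath_cons]
    cases p with
    | nil =>
      rw [ofArrow, ofPath_mul_of_eq, Quiver.Path.nil_comp]
      simp [arrowProd]
    | cons p e' => rw [ih (by simp)]

/-- A word of arrows either has two consecutive arrows that do not compose, or is the word of a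
path. The bad pair is recorded because it is itself a forbidden word of length 2. -/
theorem arrowProd_eq_zero_or (w : List (ArrowOf V)) (hw : w ≠ []) :
    ((∃ a b, [a, b] <:+: w ∧ ofArrow k a * ofArrow k b = 0) ∧ arrowProd k w = 0) ∨
      ∃ (u v : V) (p : Quiver.Path u v), word p = w := by
  induction w using List.reverseRecOn with
  | nil => exact absurd rfl hw
  | append_singleton w e ih =>
    obtain ⟨s, t, e⟩ := e
    by_cases hw' : w = []
    · subst hw'
      exact Or.inr ⟨s, t, e.toPath, rfl⟩
    · rcases ih hw' with ⟨⟨a, b, h, h0⟩, h1⟩ | ⟨u, v, p, rfl⟩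
      · exact Or.inl ⟨⟨a, b, h.trans (List.infix_append' [] w _), h0⟩,
          by rw [arrowProd_append, h1, zero_mul]⟩
      · by_cases hv : v = s
        · subst hv
          exact Or.inr ⟨u, t, p.cons e, rfl⟩
        · cases p with
          | nil => exact absurd rfl hw'
          | cons p e' =>
            refine Or.inl ⟨⟨⟨_, _, e'⟩, ⟨s, t, e⟩, ⟨word p, [], ?_⟩,
              ofPath_mul_of_ne (by exact hv)⟩, ?_⟩
            · simp only [word_cons, List.append_assoc, List.append_nil]
              rfl
            · rw [arrowProd_append, arrowProd_word k _ hw', arrowProd_singleton]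
              exact ofPath_mul_of_ne hv

-- Distinct words have products that are zero or distinct paths, so no cancellation between words
-- can occur. This yields injectivity in positive degrees.
open Classical in
theorem coord_arrowProd {u v : V} (p : Quiver.Path u v) (hp : word p ≠ [])
    (w : List (ArrowOf V)) :
    basis.coord ⟨u, v, p⟩ (arrowProd k w) = if w = word p then 1 else 0 := by
  split_ifs with h
  · rw [h, arrowProd_word k p hp, coord_ofPath_self]
  · by_cases hw : w = []
    · subst hw
      change basis.coord _ (1 : PathAlgebra k V) = 0
      rw [one_def, map_sum]
      refine Finset.sum_eq_zero fun x _ => coord_ofPath_of_ne fun hx => ?_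
      cases hx
      exact hp rfl
    · rcases arrowProd_eq_zero_or k w hw with ⟨-, h0⟩ | ⟨u', v', q, rfl⟩
      · rw [h0, map_zero]
      · rw [arrowProd_word k q hw]
        refine coord_ofPath_of_ne fun hx => h ?_
        cases hx
        rfl

end ArrowProduct

section ToConnected

open PathAlgebra BouquetVertex

variable {A : GradedAlg k} {Q : WeightedQuiver} {S : Set (PathOf Q.V)}

/-- The degree of an arrow bundled with its endpoints. -/
def arrowDeg (Q : WeightedQuiver) (e : ArrowOf Q.V) : ℕ := Q.deg e.2.2

theorem pathDeg_eq_wordDeg {u v : Q.V} (p : Quiver.Path u v) :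
    Q.pathDeg ⟨u, v, p⟩ = wordDeg (arrowDeg Q) (word p) := pathDeg_eq_sum Q p

/-- The nonempty words, of length at most `N`, of arrows whose product is zero in a given quotient
of the path algebra. -/
def zeroWords (g : PathAlgebra k Q.V →ₐ[k] A.carrier) (N : ℕ) : Set (List (ArrowOf Q.V)) :=
  {w | w ≠ [] ∧ w.length ≤ N ∧ g (arrowProd k w) = 0}

theorem finite_zeroWords (g : PathAlgebra k Q.V →ₐ[k] A.carrier) (N : ℕ) :
    (zeroWords g N).Finite :=
  (List.finite_length_le (ArrowOf Q.V) N).subset fun _ hw => hw.2.1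

/-- The bounded set of forbidden words detects every vanishing nonempty word. A vanishing word
contains a non-composable pair, or a relation from `S`, or, if `S` contains trivial paths, an arrow
at a vertex whose idempotent is zero in the quotient. -/
theorem exists_zeroWord_infix (g : PathAlgebra k Q.V →ₐ[k] A.carrier)
    (hg : ∀ x, g x = 0 ↔ x ∈ monomialIdeal k Q S) {N : ℕ} (hN : 2 ≤ N)
    (hS : ∀ p ∈ S, (word p.2.2).length ≤ N) {w : List (ArrowOf Q.V)} (hw : w ≠ [])
    (h0 : g (arrowProd k w) = 0) : ∃ s ∈ zeroWords g N, s <:+: w := by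
  -- When the trivial path at `u` lies in the ideal, so does every arrow starting at `u`, and it is
  -- a forbidden word of length 1; `hr` is the analogue for arrows ending at `v`.
  have hl : ∀ {u v : Q.V} (p : Quiver.Path u v),
      (ofPath ⟨u, u, Quiver.Path.nil⟩ : PathAlgebra k Q.V) ∈ monomialIdeal k Q S →
        word p = [] ∨ ∃ s ∈ zeroWords g N, s <:+: word p := by
    intro u v p hu
    induction p with
    | nil => exact Or.inl rfl
    | cons p e ih =>
      refine Or.inr ?_
      rcases ih with h | ⟨s, hs, h⟩
      · cases p with
        | nil =>
          refine ⟨_, ⟨by simp, by simp; omega, ?_⟩, List.infix_rfl⟩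
          rw [arrowProd_word k _ (by simp), hg, ofPath_cons]
          exact TwoSidedIdeal.mul_mem_right _ _ _ hu
        | cons p e' => simp at h
      · exact ⟨s, hs, h.trans (List.infix_append' [] _ _)⟩
  have hr : ∀ {u v : Q.V} (p : Quiver.Path u v),
      (ofPath ⟨v, v, Quiver.Path.nil⟩ : PathAlgebra k Q.V) ∈ monomialIdeal k Q S →
        word p = [] ∨ ∃ s ∈ zeroWords g N, s <:+: word p := by
    intro u v p hv
    cases p with
    | nil => exact Or.inl rfl
    | cons p e =>
      refine Or.inr ⟨[⟨_, _, e⟩], ⟨by simp, by simp; omega, ?_⟩, List.suffix_append _ _ |>.isInfix⟩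
      have h := ofPath_mul_of_eq (k := k) e.toPath (Quiver.Path.nil : Quiver.Path v v)
      rw [Quiver.Path.comp_nil] at h
      rw [arrowProd_singleton, hg, ofArrow, ← h]
      exact TwoSidedIdeal.mul_mem_left _ _ _ hv
  -- Membership in the ideal is kept in the predicate because, for a trivial path, it is what lets
  -- `hl` and `hr` handle multiplication by a further path.
  have hP : ∀ {x : PathAlgebra k Q.V}, x ∈ monomialIdeal k Q S → x ∈ Submodule.span k (ofPath ''
      {p | (ofPath p : PathAlgebra k Q.V) ∈ monomialIdeal k Q S ∧
        (word p.2.2 = [] ∨ ∃ s ∈ zeroWords g N, s <:+: word p.2.2)}) := by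
    intro x hx
    refine mem_span_of_mem_monomialIdeal _ ?_ ?_ ?_ hx
    · rintro ⟨u, v, p⟩ hp
      have hI : (ofPath ⟨u, v, p⟩ : PathAlgebra k Q.V) ∈ monomialIdeal k Q S :=
        TwoSidedIdeal.subset_span ⟨_, hp, rfl⟩
      refine ⟨hI, or_iff_not_imp_left.mpr fun h => ⟨_, ⟨h, hS _ hp, ?_⟩, List.infix_rfl⟩⟩
      rw [arrowProd_word k _ h, hg]
      exact hI
    · rintro u v w p q ⟨hI, h⟩
      refine ⟨by rw [← ofPath_mul_of_eq]; exact TwoSidedIdeal.mul_mem_right _ _ _ hI, ?_⟩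
      rcases h with h | ⟨s, hs, h⟩
      · cases p with
        | nil =>
          change word (Quiver.Path.nil.comp q) = [] ∨ ∃ s ∈ _, s <:+: word (Quiver.Path.nil.comp q)
          rw [Quiver.Path.nil_comp]
          exact hl q hI
        | cons p e => simp at h
      · exact Or.inr ⟨s, hs, by
          change s <:+: word (p.comp q)
          rw [word_comp]; exact h.trans (List.infix_append' [] _ _)⟩
    · rintro u v w p q ⟨hI, h⟩
      refine ⟨by rw [← ofPath_mul_of_eq]; exact TwoSidedIdeal.mul_mem_left _ _ _ hI, ?_⟩
      rcases h with h | ⟨s, hs, h⟩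
      · cases q with
        | nil => exact hr p hI
        | cons q e => simp at h
      · exact Or.inr ⟨s, hs, by
          change s <:+: word (p.comp q)
          rw [word_comp]; exact h.trans (List.suffix_append _ _).isInfix⟩
  rcases arrowProd_eq_zero_or k w hw with ⟨⟨a, b, hab, h⟩, -⟩ | ⟨u, v, p, rfl⟩
  · refine ⟨[a, b], ⟨by simp, by simpa using hN, ?_⟩, hab⟩
    rw [← List.singleton_append, arrowProd_append, arrowProd_singleton, arrowProd_singleton, h,
      map_zero]
  · rw [arrowProd_word k p hw, hg] at h0
    have := mem_span_ofPath_iff.mp (hP h0) ⟨u, v, p⟩ (by rw [coord_ofPath_self]; exact one_ne_zero)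
    exact this.2.resolve_left hw

/-- A monomial algebra has the same quotient category as a connected monomial algebra whose
generators are the arrows of the quiver. -/
theorem exists_qGrEquiv_wordAlg (hS : S.Finite) (g : PathAlgebra k Q.V →ₐ[k] A.carrier)
    (hgr : ∀ n, (PathAlgebra.grading k Q n).map g.toLinearMap = A.grading n)
    (hg : ∀ x, g x = 0 ↔ x ∈ monomialIdeal k Q S) :
    ∃ F : Set (List (ArrowOf Q.V)), F.Finite ∧
      QGrEquiv A (wordAlg k (arrowDeg Q) (fun e => Q.one_le_deg e.2.2) F) := by
  obtain ⟨N, hN, hSN⟩ : ∃ N, 2 ≤ N ∧ ∀ p ∈ S, (word p.2.2).length ≤ N := by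
    obtain ⟨N, hN⟩ := (hS.image fun p => (word p.2.2).length).bddAbove
    -- Length 2 must be allowed even when the relations are shorter, to forbid the non-composable
    -- pairs of arrows.
    exact ⟨N + 2, by omega, fun p hp => (hN ⟨p, hp, rfl⟩).trans (by omega)⟩
  refine ⟨zeroWords g N, finite_zeroWords g N, ?_⟩
  have hd : ∀ e, 1 ≤ arrowDeg Q e := fun e => Q.one_le_deg e.2.2
  have hgmem : ∀ {n x}, x ∈ PathAlgebra.grading k Q n → g x ∈ A.grading n := fun {n x} hx =>
    hgr n ▸ Submodule.mem_map_of_mem hx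
  have hprod : ∀ w : List (ArrowOf Q.V), (w.map fun e => g (ofArrow k e)).prod =
      g (arrowProd k w) := fun w => by
    rw [arrowProd, map_list_prod, List.map_map]; rfl
  obtain ⟨f, hf⟩ := exists_hom_wordAlg (arrowDeg Q) hd (F := zeroWords g N) A 1
    (fun e => g (ofArrow k e)) (one_mul 1) (fun _ => mul_one _)
    (GrNUHom.one_mem_grading A)
    (fun e => by
      have := hgmem (ofPath_mem_grading (k := k) Q ⟨e.1, e.2.1, e.2.2.toPath⟩)
      rwa [pathDeg_eq_wordDeg, show word e.2.2.toPath = [e] from rfl, wordDeg_cons, wordDeg_nil,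
        add_zero] at this)
    (fun s hs => by rw [one_mul, hprod]; exact hs.2.2)
  replace hf : ∀ w, f (wordClass k (arrowDeg Q) hd (zeroWords g N) w) = g (arrowProd k w) :=
    fun w => by rw [hf, one_mul, hprod]
  have hf1 : f 1 = 1 := by
    rw [← wordClass_nil, hf]
    exact map_one g
  have hfsurj : ∀ n ≥ 1, ∀ b ∈ A.grading n,
      ∃ a ∈ (wordAlg k (arrowDeg Q) hd (zeroWords g N)).grading n, f a = b := by
    intro n hn b hb
    rw [← hgr n] at hb
    obtain ⟨x, hx, rfl⟩ := hb
    induction hx using Submodule.span_induction with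
    | mem x hx =>
      obtain ⟨⟨u, v, p⟩, hp, rfl⟩ := hx
      replace hp : wordDeg (arrowDeg Q) (word p) = n := (pathDeg_eq_wordDeg p).symm.trans hp
      have hne : word p ≠ [] := fun h => by rw [h, wordDeg_nil] at hp; omega
      refine ⟨wordClass k _ hd _ (word p), hp ▸ wordClass_mem_grading _ _ _ _, ?_⟩
      rw [hf, arrowProd_word k p hne]
      rfl
    | zero => exact ⟨0, Submodule.zero_mem _, by rw [map_zero, map_zero]⟩
    | add x y _ _ hx hy =>
      obtain ⟨a, ha, ha'⟩ := hx
      obtain ⟨b, hb, hb'⟩ := hy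
      exact ⟨a + b, Submodule.add_mem _ ha hb, by rw [map_add, ha', hb', map_add]⟩
    | smul c x _ hx =>
      obtain ⟨a, ha, ha'⟩ := hx
      exact ⟨c • a, Submodule.smul_mem _ c ha, by rw [map_smul, ha', map_smul]⟩
  have hfinj : ∀ n ≥ 1, ∀ a ∈ (wordAlg k (arrowDeg Q) hd (zeroWords g N)).grading n,
      f a = 0 → a = 0 := by
    rintro n hn _ ⟨x, hx, rfl⟩ h0
    refine MonomialAlgebra.mk_eq_zero_iff.mpr (mem_monomialIdeal_iff.mpr fun p hp => ?_)
    obtain ⟨w, rfl⟩ : ∃ w, pathOf w = p := ⟨_, pathOf_letters p⟩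
    have hwn : wordDeg (arrowDeg Q) w = n := by
      rw [← pathDeg_pathOf (arrowDeg Q) hd w]
      by_contra hne
      exact hp (coord_eq_zero_of_mem_grading _ hx hne)
    have hw : w ≠ [] := fun h => by rw [h, wordDeg_nil] at hwn; omega
    refine MonomialAlgebra.mk_eq_zero_iff.mp (wordClass_eq_zero (arrowDeg Q) hd
      (exists_zeroWord_infix g hg hN hSN hw ?_))
    rcases arrowProd_eq_zero_or k w hw with ⟨-, h⟩ | ⟨u, v, q, rfl⟩
    · rw [h, map_zero]
    -- The coefficient of the word of `q` in `x` equals the coefficient of the path `q` in `f₀ x`,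
    -- which lies in the monomial ideal. A nonzero coefficient therefore forces `q` into the ideal.
    · let f₀ : PathAlgebra k (BouquetVertex (ArrowOf Q.V)) →ₙₐ[k] PathAlgebra k Q.V :=
        bouquetLift k 1 (ofArrow k) (one_mul 1) fun _ => mul_one _
      have hf₀ : ∀ w, f₀ (monomial k w) = arrowProd k w := fun w =>
        (bouquetLift_monomial 1 (ofArrow k) _ _ w).trans (one_mul _)
      have e1 : (f.toHom : (wordAlg k (arrowDeg Q) hd (zeroWords g N)).carrier →ₗ[k] A.carrier) ∘ₗ
          (MonomialAlgebra.mk k (bouquet _ (arrowDeg Q) hd) (pathOf '' zeroWords g N)).toLinearMap =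
          g.toLinearMap ∘ₗ (f₀ : _ →ₗ[k] PathAlgebra k Q.V) :=
        lhom_ext_monomial fun w => (hf w).trans (congrArg g (hf₀ w)).symm
      have e2 : (basis.coord ⟨u, v, q⟩) ∘ₗ (f₀ : _ →ₗ[k] PathAlgebra k Q.V) =
          basis.coord (pathOf (word q)) := by
        refine lhom_ext_monomial fun w => ?_
        change basis.coord _ (f₀ (monomial k w)) = _
        rw [hf₀, coord_arrowProd k q hw]
        split_ifs with h
        · rw [h]
          exact (coord_ofPath_self _).symm
        · exact (coord_ofPath_of_ne fun h' => h (pathOf_injective h')).symm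
      have h1 : f₀ x ∈ monomialIdeal k Q S := (hg _).mp ((LinearMap.congr_fun e1 x).symm.trans h0)
      rw [arrowProd_word k q hw, hg]
      refine mem_monomialIdeal_iff.mp h1 _ ?_
      rw [← LinearMap.congr_fun e2 x] at hp
      exact hp
  have hfinA : A.LocallyFinite := fun n => by
    have := PathAlgebra.finite_grading (k := k) Q n
    rw [← hgr n]
    infer_instance
  obtain ⟨D, hD⟩ : ∃ D, ∀ e, arrowDeg Q e ≤ D := by
    obtain ⟨D, hD⟩ := (Set.finite_range (arrowDeg Q)).bddAbove
    exact ⟨D, fun e => hD ⟨e, rfl⟩⟩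
  -- The map is unital and surjective in positive degrees, so `{1}` suffices as the set of left
  -- factors. The bound `n + D + 1` lets a word be cut into a prefix of degree between `n` and `n +
  -- D` and a remainder of positive degree.
  refine GrNUHom.IsTailEquiv.qGrEquiv (f := f) (m := 1)
    ⟨locallyFinite_wordAlg _ _ _, hfinA, f.exists_lift_of_bijective 1 hf1 hfinj hfsurj,
      {1}, fun n => ⟨n + D + 1, fun j hj b hb => ?_⟩⟩
  obtain ⟨a, ha, rfl⟩ := hfsurj j (by omega) b hb
  rw [grading_wordAlg] at ha
  induction ha using Submodule.span_induction with
  | mem a ha =>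
    obtain ⟨w, hw, rfl⟩ := ha
    replace hw : wordDeg (arrowDeg Q) w = j := hw
    obtain ⟨w₁, w₂, rfl, h1, h2⟩ := exists_split_word (arrowDeg Q) hD w n (by omega)
    rw [wordDeg_append] at hw
    refine Submodule.subset_span ⟨1, Finset.mem_singleton_self _, _, h1, _,
      wordClass_mem_grading _ _ _ w₁, _, ?_, _, wordClass_mem_grading _ _ _ w₂, 1, ?_⟩
    · omega
    · rw [wordClass_append, map_mul, one_mul, mul_one]
  | zero => rw [map_zero]; exact Submodule.zero_mem _
  | add x y _ _ hx hy =>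
    rw [map_add]
    exact Submodule.add_mem _ (hx (f.map_mem (by rwa [grading_wordAlg])))
      (hy (f.map_mem (by rwa [grading_wordAlg])))
  | smul c x _ hx =>
    rw [map_smul]
    exact Submodule.smul_mem _ c (hx (f.map_mem (by rwa [grading_wordAlg])))

end ToConnected

/-! ### From connected monomial algebras to path algebras -/

/-- A word avoids a set of words if it has no factor in that set. -/
def Avoids {E : Type} (F : Set (List E)) (w : List E) : Prop := ∀ s ∈ F, ¬ s <:+: w

theorem Avoids.of_infix {E : Type} {F : Set (List E)} {v w : List E} (hw : Avoids F w)
    (h : v <:+: w) : Avoids F v := fun s hs hsv => hw s hs (hsv.trans h)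

theorem not_avoids_iff {E : Type} {F : Set (List E)} {w : List E} :
    ¬ Avoids F w ↔ ∃ s ∈ F, s <:+: w := by simp [Avoids]

/-- A finite weighted alphabet, together with forbidden words of length at most `L + 1`, and with a
bound for the weights of the letters. -/
structure WordData where
  /-- the letters -/
  E : Type
  [finite : Finite E]
  /-- the weights of the letters -/
  d : E → ℕ
  one_le : ∀ a, 1 ≤ d a
  /-- the forbidden words -/
  F : Set (List E)
  /-- the length of the memory -/
  L : ℕ
  length_le : ∀ s ∈ F, s.length ≤ L + 1
  /-- a bound for the weights -/
  D : ℕ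
  le_bound : ∀ a, d a ≤ D
  one_le_bound : 1 ≤ D

attribute [instance] WordData.finite

/-! ### The graph of a connected monomial algebra -/

namespace WordData

variable (R : WordData)

/-- The allowed words of length `L`. -/
def State : Type := {w : List R.E // w.length = R.L ∧ Avoids R.F w}

instance : Finite R.State :=
  Set.Finite.to_subtype ((List.finite_length_eq R.E R.L).subset fun _ h => h.1)

/-- The vertices of the graph of a monomial algebra: a vertex consists of the last `L` letters that
have been read and of the number of steps that remain until the last letter is completely read. -/
@[ext]
structure Vertex : Type where
  /-- the last letters that have been read -/
  state : R.State
  /-- the number of steps that remain -/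
  rem : Fin (R.D + 1)

instance : Finite R.Vertex :=
  Finite.of_injective (fun x : R.Vertex => (x.1, x.2)) fun _ _ h =>
    Vertex.ext (congrArg Prod.fst h) (congrArg Prod.snd h)
instance : Fintype R.Vertex := Fintype.ofFinite _
instance : Fintype R.State := Fintype.ofFinite _

variable {R}

/-- The condition for a step between two vertices which either continues with the current letter
or starts with the next one. -/
def IsStep (x y : R.Vertex) : Option R.E → Prop
  | none => y.1 = x.1 ∧ x.2.val = y.2.val + 1
  | some a => x.2.val = 0 ∧ y.2.val + 1 = R.d a ∧ Avoids R.F (x.1.1 ++ [a]) ∧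
      y.1.1 = (x.1.1 ++ [a]).tail

instance : Quiver.{0} R.Vertex := ⟨fun x y => {o : Option R.E // IsStep x y o}⟩

/-- The arrow given by a step. -/
def step {x y : R.Vertex} (o : Option R.E) (h : IsStep x y o) : x ⟶ y := ⟨o, h⟩

variable (R) in
/-- The graph of a monomial algebra. -/
abbrev graph : WeightedQuiver where
  V := R.Vertex
  finiteArrows x y := inferInstanceAs (Finite {o : Option R.E // IsStep x y o})
  deg _ := 1
  one_le_deg _ := le_rfl

theorem pathDeg_graph {x y : R.Vertex} (p : Quiver.Path x y) :
    R.graph.pathDeg ⟨x, y, p⟩ = p.length := by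
  induction p with
  | nil => exact pathDeg_nil _ _
  | cons p e ih => exact (pathDeg_cons R.graph p e).trans (congrArg (· + 1) ih)

/-- The letters of an arrow. -/
def arrowLabel {x y : R.Vertex} (α : x ⟶ y) : List R.E := α.1.toList

/-- The letters whose reading starts on a path. -/
def label {x : R.Vertex} : ∀ {y : R.Vertex}, Quiver.Path x y → List R.E
  | _, Quiver.Path.nil => []
  | _, Quiver.Path.cons p α => label p ++ arrowLabel α

@[simp] theorem label_nil (x : R.Vertex) : label (Quiver.Path.nil : Quiver.Path x x) = [] := rfl

@[simp] theorem label_cons {x y z : R.Vertex} (p : Quiver.Path x y) (α : y ⟶ z) :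
    label (p.cons α) = label p ++ arrowLabel α := rfl

@[simp] theorem label_comp {x y z : R.Vertex} (p : Quiver.Path x y) (q : Quiver.Path y z) :
    label (p.comp q) = label p ++ label q := by
  induction q with
  | nil => simp
  | cons q e ih => simp [ih]

theorem wordDeg_arrowLabel {x y : R.Vertex} (α : x ⟶ y) :
    y.2.val + 1 = x.2.val + wordDeg R.d (arrowLabel α) := by
  obtain ⟨o, ho⟩ := α
  cases o with
  | none => simp [arrowLabel, ho.2]
  | some a => simp [arrowLabel, ho.1, ho.2.1]

/-- Conservation of degree: starting a letter contributes its weight to the steps still due, and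
each arrow uses up one step. -/
theorem length_add_eq {x y : R.Vertex} (p : Quiver.Path x y) :
    p.length + y.2.val = x.2.val + wordDeg R.d (label p) := by
  induction p with
  | nil => simp
  | cons p α ih =>
    have := wordDeg_arrowLabel α
    rw [Quiver.Path.length_cons, label_cons, wordDeg_append]
    omega

/-- The state is a sliding window: each letter that is started enters on the right and pushes out
the oldest one. -/
theorem state_eq_drop {x y : R.Vertex} (p : Quiver.Path x y) :
    y.1.1 = (x.1.1 ++ label p).drop (label p).length := by
  induction p with
  | nil => simp
  | cons p α ih =>
    obtain ⟨o, ho⟩ := α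
    cases o with
    | none =>
      rw [ho.1, ih]
      simp [arrowLabel]
    | some a =>
      rw [ho.2.2.2, ih, ← List.drop_one]
      have h : (x.1.1 ++ (label p ++ [a])).drop (label p).length =
          (x.1.1 ++ label p).drop (label p).length ++ [a] := by
        rw [← List.append_assoc, List.drop_append_of_le_length (by simp)]
      rw [← h, List.drop_drop]
      simp [arrowLabel]

/-- The vertex at which a letter has been read completely. -/
def stateVertex (p : R.State) : R.Vertex := ⟨p, ⟨0, Nat.succ_pos _⟩⟩

theorem eq_stateVertex {x : R.Vertex} (h : x.2.val = 0) : x = stateVertex x.1 :=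
  Vertex.ext rfl (Fin.ext h)

/-- The path completing the current letter. -/
def tailPath (p : R.State) : ∀ (j : ℕ) (hj : j < R.D + 1),
    Quiver.Path (⟨p, ⟨j, hj⟩⟩ : R.Vertex) (stateVertex p)
  | 0, _ => Quiver.Path.nil
  | j + 1, hj => (Quiver.Hom.toPath (step (x := ⟨p, ⟨j + 1, hj⟩⟩)
      (y := ⟨p, ⟨j, Nat.lt_of_succ_lt hj⟩⟩) none ⟨rfl, rfl⟩)).comp
        (tailPath p j (Nat.lt_of_succ_lt hj))

theorem label_tailPath (p : R.State) (j : ℕ) (hj : j < R.D + 1) : label (tailPath p j hj) = [] := by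
  induction j with
  | zero => rfl
  | succ j ih =>
    rw [tailPath, label_comp, ih]
    rfl

/-- The state reached by reading a letter. -/
def next (p : R.State) (a : R.E) (h : Avoids R.F (p.1 ++ [a])) : R.State :=
  ⟨(p.1 ++ [a]).tail, by simp [p.2.1], h.of_infix (List.tail_suffix _).isInfix⟩

theorem pred_lt (a : R.E) : R.d a - 1 < R.D + 1 := by
  have := R.le_bound a
  omega

/-- The path reading a letter. -/
def stepPath (p : R.State) (a : R.E) (h : Avoids R.F (p.1 ++ [a])) :
    Quiver.Path (stateVertex p) (stateVertex (next p a h)) :=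
  (Quiver.Hom.toPath (step (x := stateVertex p) (y := ⟨next p a h, ⟨R.d a - 1, pred_lt a⟩⟩)
    (some a) ⟨rfl, Nat.sub_add_cancel (R.one_le a), h, rfl⟩)).comp (tailPath _ _ _)

theorem label_stepPath (p : R.State) (a : R.E) (h : Avoids R.F (p.1 ++ [a])) :
    label (stepPath p a h) = [a] := by
  rw [stepPath, label_comp, label_tailPath]
  rfl

/-- Whether a word is forbidden can be decided by looking at its factors of length `L + 1`. -/
theorem avoids_cons_iff (p : R.State) (a : R.E) (u : List R.E) (h : Avoids R.F (p.1 ++ [a])) :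
    Avoids R.F (p.1 ++ a :: u) ↔ Avoids R.F ((next p a h).1 ++ u) := by
  obtain ⟨b, t, hbt⟩ : ∃ b t, p.1 ++ [a] = b :: t := List.exists_cons_of_ne_nil (by simp)
  have h1 : p.1 ++ a :: u = b :: (t ++ u) := by
    rw [← List.singleton_append, ← List.append_assoc, hbt, List.cons_append]
  have h2 : (next p a h).1 = t := by
    change (p.1 ++ [a]).tail = t
    rw [hbt, List.tail_cons]
  rw [h1, h2]
  refine ⟨fun h' => h'.of_infix (List.suffix_cons _ _).isInfix, fun h' s hs hsw => ?_⟩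
  -- A forbidden factor beginning at the very first letter has length at most `L + 1`, so it already
  -- lies inside `p.1 ++ [a]`; any other factor survives the removal of that letter.
  rcases List.infix_cons_iff.mp hsw with hsw | hsw
  · have h3 : b :: t <+: b :: (t ++ u) := ⟨u, rfl⟩
    refine h s hs ?_
    rw [hbt]
    refine (List.prefix_of_prefix_length_le hsw h3 ?_).isInfix
    rw [← hbt]
    simpa [p.2.1] using R.length_le s hs
  · exact h' s hs hsw

open PathAlgebra

variable (k)

/-- The idempotent of a state. -/
def stateIdem (p : R.State) : PathAlgebra k R.Vertex :=
  ofPath ⟨stateVertex p, stateVertex p, Quiver.Path.nil⟩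

variable (R) in
/-- The sum of the idempotents of the states. -/
def idem : PathAlgebra k R.Vertex := ∑ p : R.State, stateIdem k p

open Classical in
/-- The part starting at a given state of the image of a letter. -/
def letterAt (p : R.State) (a : R.E) : PathAlgebra k R.Vertex :=
  if h : Avoids R.F (p.1 ++ [a]) then ofPath ⟨_, _, stepPath p a h⟩ else 0

/-- The image of a letter in the path algebra of the graph. -/
def letter (a : R.E) : PathAlgebra k R.Vertex := ∑ p : R.State, letterAt k p a

/-- The product of the images of the letters of a word. -/
def letters (w : List R.E) : PathAlgebra k R.Vertex := (w.map (letter k)).prod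

theorem letters_append (u v : List R.E) : letters k (u ++ v) = letters k u * letters k v := by
  simp [letters]

theorem letters_cons (a : R.E) (v : List R.E) : letters k (a :: v) = letter k a * letters k v := by
  simp [letters]

theorem letters_nil : letters k ([] : List R.E) = 1 := rfl

variable {k}

theorem ofPath_mul_stateIdem {x : R.Vertex} {p : R.State}
    (π : Quiver.Path x (stateVertex p)) :
    (ofPath ⟨x, _, π⟩ * stateIdem k p : PathAlgebra k R.Vertex) = ofPath ⟨x, _, π⟩ :=
  ofPath_mul_of_eq π Quiver.Path.nil

theorem stateIdem_mul_ofPath {y : R.Vertex} {p : R.State}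
    (π : Quiver.Path (stateVertex p) y) :
    (stateIdem k p * ofPath ⟨_, y, π⟩ : PathAlgebra k R.Vertex) = ofPath ⟨_, y, π⟩ := by
  refine (ofPath_mul_of_eq Quiver.Path.nil π).trans ?_
  rw [Quiver.Path.nil_comp]

theorem stateVertex_injective : Function.Injective (stateVertex : R.State → R.Vertex) :=
  fun _ _ h => congrArg Vertex.state h

theorem ofPath_mul_letterAt_of_ne {x y : R.Vertex} (π : Quiver.Path x y) {p : R.State}
    (h : y ≠ stateVertex p) (a : R.E) : (ofPath ⟨x, y, π⟩ : PathAlgebra k R.Vertex) *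
      letterAt k p a = 0 := by
  unfold letterAt
  split_ifs
  · exact ofPath_mul_of_ne h
  · exact mul_zero _

theorem ofPath_mul_letter {x : R.Vertex} {p : R.State} (π : Quiver.Path x (stateVertex p))
    (a : R.E) : (ofPath ⟨x, _, π⟩ : PathAlgebra k R.Vertex) * letter k a =
      ofPath ⟨x, _, π⟩ * letterAt k p a := by
  rw [letter, Finset.mul_sum]
  refine Finset.sum_eq_single p (fun q _ hq => ofPath_mul_letterAt_of_ne π ?_ a)
    fun h => absurd (Finset.mem_univ p) h
  exact fun h => hq (stateVertex_injective h).symm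

theorem stateIdem_mul_letter (p : R.State) (a : R.E) :
    stateIdem k p * letter k a = letterAt k p a := by
  rw [stateIdem, ofPath_mul_letter]
  unfold letterAt
  split_ifs
  · exact stateIdem_mul_ofPath _
  · exact mul_zero _

theorem ofPath_mul_idem {x : R.Vertex} {p : R.State} (π : Quiver.Path x (stateVertex p)) :
    (ofPath ⟨x, _, π⟩ : PathAlgebra k R.Vertex) * idem k R = ofPath ⟨x, _, π⟩ := by
  rw [idem, Finset.mul_sum]
  refine (Finset.sum_eq_single p (fun q _ hq => ofPath_mul_of_ne ?_)
    fun h => absurd (Finset.mem_univ p) h).trans (ofPath_mul_stateIdem π)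
  exact fun h => hq (stateVertex_injective h).symm

theorem ofPath_mul_idem_of_ne {x y : R.Vertex} (π : Quiver.Path x y) (hy : y.2.val ≠ 0) :
    (ofPath ⟨x, y, π⟩ : PathAlgebra k R.Vertex) * idem k R = 0 := by
  rw [idem, Finset.mul_sum]
  refine Finset.sum_eq_zero fun q _ => ofPath_mul_of_ne ?_
  rintro rfl
  exact hy rfl

theorem stateIdem_mul_idem (p : R.State) : stateIdem k p * idem k R = stateIdem k p :=
  ofPath_mul_idem _

theorem idem_mul_idem : idem k R * idem k R = idem k R := by
  conv_lhs => enter [1]; rw [idem]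
  rw [Finset.sum_mul]
  exact Finset.sum_congr rfl fun p _ => stateIdem_mul_idem p

theorem letter_mul_idem (a : R.E) : letter k a * idem k R = letter k a := by
  rw [letter, Finset.sum_mul]
  refine Finset.sum_congr rfl fun p _ => ?_
  unfold letterAt
  split_ifs
  · exact ofPath_mul_idem _
  · exact zero_mul _

/-- The path reading a word, when the word can be read. -/
theorem exists_path_eq (p : R.State) (u : List R.E) (h : Avoids R.F (p.1 ++ u)) :
    ∃ (q : R.State) (π : Quiver.Path (stateVertex p) (stateVertex q)), label π = u ∧
      stateIdem k p * letters k u = ofPath ⟨_, _, π⟩ := by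
  induction u generalizing p with
  | nil => exact ⟨p, Quiver.Path.nil, rfl, by rw [letters_nil, mul_one, stateIdem]⟩
  | cons a u ih =>
    have ha : Avoids R.F (p.1 ++ [a]) := h.of_infix ⟨[], u, by simp⟩
    obtain ⟨q, π, hπ, h1⟩ := ih (next p a ha) ((avoids_cons_iff p a u ha).mp h)
    refine ⟨q, (stepPath p a ha).comp π, by rw [label_comp, label_stepPath, hπ]; rfl, ?_⟩
    rw [letters_cons, ← mul_assoc, stateIdem_mul_letter, letterAt, dif_pos ha,
      ← ofPath_mul_of_eq, ← h1, ← mul_assoc, ofPath_mul_stateIdem]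

/-- Reading `u` from `p` fails at the first letter that completes a forbidden word. In particular
the images of the relations vanish, which makes the homomorphism to the path algebra well defined.
-/
theorem stateIdem_mul_letters_eq_zero (p : R.State) (u : List R.E)
    (h : ¬ Avoids R.F (p.1 ++ u)) : stateIdem k p * letters k u = 0 := by
  induction u generalizing p with
  | nil => exact absurd (by rw [List.append_nil]; exact p.2.2) h
  | cons a u ih =>
    rw [letters_cons, ← mul_assoc, stateIdem_mul_letter]
    unfold letterAt
    split_ifs with ha
    · rw [← ofPath_mul_stateIdem, mul_assoc, ih _ (fun h' => h ((avoids_cons_iff p a u ha).mpr h')),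
        mul_zero]
    · rw [zero_mul]

/-- The path completing the current letter, as an element of the path algebra. -/
def tail (k : Type u) [Field k] (x : R.Vertex) : PathAlgebra k R.Vertex :=
  ofPath ⟨x, stateVertex x.1, tailPath x.1 x.2.val x.2.isLt⟩

theorem tail_stateVertex (p : R.State) : tail k (stateVertex p) = stateIdem k p := rfl

theorem tail_mul_idem (x : R.Vertex) : tail k x * idem k R = tail k x := ofPath_mul_idem _

/-- An arrow inside a letter is the first step of the completion from `x`. An arrow that starts `a`
leaves from a state, and completing `a` afterwards gives the full path reading `a`. -/
theorem ofArrow_mul_tail {x y : R.Vertex} (α : x ⟶ y) :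
    ofArrow k ⟨x, y, α⟩ * tail k y = tail k x * letters k (arrowLabel α) := by
  obtain ⟨o, ho⟩ := α
  obtain ⟨p, i, hi⟩ := x
  obtain ⟨q, j, hj⟩ := y
  cases o with
  | none =>
    obtain ⟨h1, h2⟩ := ho
    dsimp only at h1 h2
    subst h1 h2
    exact (ofPath_mul_of_eq _ _).trans (mul_one _).symm
  | some a =>
    obtain ⟨h1, h2, h3, h4⟩ := ho
    dsimp only at h1 h2 h3 h4
    subst h1
    obtain rfl : q = next p a h3 := Subtype.ext h4
    obtain rfl : j = R.d a - 1 := by omega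
    refine (ofPath_mul_of_eq _ _).trans ?_
    change _ = stateIdem k p * (letter k a * 1)
    rw [mul_one, stateIdem_mul_letter, letterAt, dif_pos h3]
    rfl

/-- A path is determined by its initial vertex and its label, up to the completion of the last
letter. -/
theorem ofPath_mul_tail {x y : R.Vertex} (π : Quiver.Path x y) :
    ofPath ⟨x, y, π⟩ * tail k y = tail k x * letters k (label π) := by
  induction π with
  | nil =>
    refine (ofPath_mul_of_eq _ _).trans ?_
    rw [label_nil, letters_nil, mul_one, Quiver.Path.nil_comp]
    rfl
  | cons π α ih =>
    rw [ofPath_cons, mul_assoc, ofArrow_mul_tail, ← mul_assoc, ih, label_cons, letters_append,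
      mul_assoc]

theorem ofPath_eq_tail_mul {x : R.Vertex} {p : R.State} (π : Quiver.Path x (stateVertex p)) :
    ofPath ⟨x, _, π⟩ = tail k x * letters k (label π) := by
  rw [← ofPath_mul_tail, tail_stateVertex, ofPath_mul_stateIdem]

/-- A sufficiently long path starts with the completion of the current letter, followed by the
reading of a word. -/
theorem ofPath_factor {x y : R.Vertex} (π : Quiver.Path x y) :
    (∃ v c, ofPath ⟨x, y, π⟩ = tail k x * letters k v * c ∧
      π.length + y.2.val ≤ x.2.val + wordDeg R.d v + R.D) ∨ π.length + y.2.val ≤ x.2.val := by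
  induction π with
  | nil => exact Or.inr (by simp)
  | cons π α ih =>
    rename_i y z
    rw [ofPath_cons, Quiver.Path.length_cons]
    have hα := wordDeg_arrowLabel α
    obtain ⟨o, ho⟩ := α
    cases o with
    | none =>
      replace hα : z.2.val + 1 = y.2.val := hα
      rcases ih with ⟨v, c, h1, h2⟩ | h
      · exact Or.inl ⟨v, c * ofArrow k ⟨y, z, step none ho⟩, by rw [h1, mul_assoc]; rfl, by omega⟩
      · exact Or.inr (by omega)
    | some a =>
      -- The path is cut where its last letter starts: there `y` has no steps remaining, so `π` is a
      -- completion followed by the reading of its whole label. What comes after has at most the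
      -- weight of one letter, whence `R.D`.
      refine Or.inl ⟨label π, ofArrow k ⟨y, z, step (some a) ho⟩, ?_, ?_⟩
      · congr 1
        obtain ⟨p, hp⟩ : ∃ p, y = stateVertex p := ⟨_, eq_stateVertex ho.1⟩
        subst hp
        exact ofPath_eq_tail_mul π
      · have h1 := length_add_eq π
        have h2 := R.le_bound a
        have h3 := ho.1
        have h4 := ho.2.1
        omega

/-- The image of a long word is supported on the paths that end at the state formed by its last
letters. -/
theorem idem_mul_letters_mul_ofPath {u : List R.E} (hu : R.L ≤ u.length) {x y : R.Vertex}
    (π : Quiver.Path x y) (hx : x.2.val = 0 → x.1.1 ≠ u.drop (u.length - R.L)) :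
    idem k R * letters k u * ofPath ⟨x, y, π⟩ = 0 := by
  rw [idem, Finset.sum_mul, Finset.sum_mul]
  refine Finset.sum_eq_zero fun p _ => ?_
  by_cases h : Avoids R.F (p.1 ++ u)
  · obtain ⟨q, π', hπ', h1⟩ := exists_path_eq (k := k) p u h
    rw [h1]
    refine ofPath_mul_of_ne ?_
    rintro rfl
    refine hx rfl ?_
    have := state_eq_drop π'
    rw [hπ'] at this
    refine this.trans ?_
    rw [show (stateVertex p).1.1 = p.1 from rfl, List.drop_append, p.2.1,
      List.drop_eq_nil_of_le (by rw [p.2.1]; exact hu), List.nil_append]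
  · rw [stateIdem_mul_letters_eq_zero p u h, zero_mul]

/-- Wherever the reading of `u` starts, its last `L` letters fill the window, so all terms end at
the same state `q`. -/
theorem idem_mul_letters_mul_stateIdem {u : List R.E} (hu : R.L ≤ u.length) {q : R.State}
    (hq : q.1 = u.drop (u.length - R.L)) :
    idem k R * letters k u * stateIdem k q = idem k R * letters k u := by
  have h1 : idem k R * letters k u * 1 = idem k R * letters k u * stateIdem k q := by
    rw [one_def, Finset.mul_sum]
    refine Finset.sum_eq_single (stateVertex q) (fun x _ hx => ?_)
      fun h => absurd (Finset.mem_univ _) h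
    refine idem_mul_letters_mul_ofPath hu _ fun h0 h => hx ?_
    rw [eq_stateVertex h0]
    congr 1
    exact Subtype.ext (h.trans hq.symm)
  rw [← h1, mul_one]
end WordData

/-! ### The homomorphism to the path algebra of the graph and its lifts -/

namespace WordData

open PathAlgebra

variable (k) (R : WordData)

/-- The monomial algebra of a `WordData`. -/
abbrev alg : GradedAlg k := wordAlg k R.d R.one_le R.F

/-- The class of a word in the monomial algebra. -/
abbrev cls (w : List R.E) : (R.alg k).carrier := wordClass k R.d R.one_le R.F w

theorem letter_mem_grading (a : R.E) : letter k a ∈ PathAlgebra.grading k R.graph (R.d a) := by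
  refine Submodule.sum_mem _ fun p _ => ?_
  unfold letterAt
  split_ifs with h
  · have h1 := ofPath_mem_grading (k := k) R.graph ⟨_, _, stepPath p a h⟩
    have h2 : (stepPath p a h).length + 0 = 0 + wordDeg R.d (label (stepPath p a h)) :=
      length_add_eq _
    rwa [pathDeg_graph, ← Nat.add_zero (Quiver.Path.length _), h2, label_stepPath, wordDeg_cons,
      wordDeg_nil, zero_add, add_zero] at h1
  · exact Submodule.zero_mem _

theorem idem_mem_grading : idem k R ∈ PathAlgebra.grading k R.graph 0 := by
  refine Submodule.sum_mem _ fun p _ => ?_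
  have h := ofPath_mem_grading (k := k) R.graph ⟨stateVertex p, stateVertex p, Quiver.Path.nil⟩
  rwa [pathDeg_graph] at h

/-- The homomorphism from a monomial algebra to the path algebra of its graph. -/
theorem exists_hom : ∃ f : GrNUHom (R.alg k) (pathGradedAlg k R.graph),
    ∀ w, f (R.cls k w) = (idem k R * letters k w : PathAlgebra k R.Vertex) := by
  refine exists_hom_wordAlg R.d R.one_le (pathGradedAlg k R.graph) (idem k R) (letter k)
    idem_mul_idem letter_mul_idem (R.idem_mem_grading k) (R.letter_mem_grading k) fun s hs => ?_
  change (idem k R * letters k s : PathAlgebra k R.Vertex) = 0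
  rw [idem, Finset.sum_mul]
  exact Finset.sum_eq_zero fun p _ => stateIdem_mul_letters_eq_zero p s fun h =>
    h s hs (List.suffix_append _ _).isInfix

theorem wordDeg_le (w : List R.E) : wordDeg R.d w ≤ R.D * w.length := by
  induction w with
  | nil => simp
  | cons a w ih =>
    rw [wordDeg_cons, List.length_cons, Nat.mul_add, mul_one]
    have := R.le_bound a
    omega

variable {R}

/-- The vertices at which one can continue to read a word. -/
def EndsAt (u : List R.E) (x : R.Vertex) : Prop :=
  x.2.val = 0 ∧ x.1.1 = u.drop (u.length - R.L)

theorem EndsAt.suffix {u : List R.E} {x : R.Vertex} (h : EndsAt u x) : x.1.1 <:+ u := by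
  rw [h.2]
  exact List.drop_suffix _ _

open Classical in
/-- Continuing to read a word along a path. -/
def continueMap (u : List R.E) : PathAlgebra k R.Vertex →ₗ[k] (R.alg k).carrier :=
  basis.constr k fun π =>
    if EndsAt u π.1 ∧ π.2.1.2.val = 0 then R.cls k (u ++ label π.2.2) else 0

variable {k}

theorem continueMap_of_endsAt {u : List R.E} {x : R.Vertex} {q : R.State}
    (π : Quiver.Path x (stateVertex q)) (hx : EndsAt u x) :
    continueMap k u (ofPath ⟨x, _, π⟩) = R.cls k (u ++ label π) :=
  (basis.constr_basis k _ _).trans (if_pos ⟨hx, rfl⟩)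

theorem continueMap_eq_zero {u : List R.E} {x y : R.Vertex} (π : Quiver.Path x y)
    (h : EndsAt u x → y.2.val ≠ 0) : continueMap k u (ofPath ⟨x, y, π⟩) = 0 :=
  (basis.constr_basis k _ _).trans (if_neg fun h' => h h'.1 h'.2)

/-- Among the trivial paths only the one at the last `L` letters of `u` contributes; these letters
do form a state, since `u` is long enough and allowed. -/
theorem continueMap_one {u : List R.E} (hu : R.L ≤ u.length) (ha : Avoids R.F u) :
    continueMap k u 1 = R.cls k u := by
  let q : R.State := ⟨u.drop (u.length - R.L), by rw [List.length_drop]; omega,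
    ha.of_infix (List.drop_suffix _ _).isInfix⟩
  rw [one_def, map_sum, Finset.sum_eq_single (stateVertex q)]
  · refine (continueMap_of_endsAt _ ⟨rfl, rfl⟩).trans ?_
    rw [label_nil, List.append_nil]
  · refine fun x _ hx => continueMap_eq_zero _ fun h _ => hx ?_
    rw [eq_stateVertex h.1]
    exact congrArg _ (Subtype.ext h.2)
  · exact fun h => absurd (Finset.mem_univ _) h

/-- After a path that ends at a state, multiplication by the image of `v` appends the path reading
`v`, hence appends `v` to the label. If `v` cannot be read there, both sides vanish. -/
theorem continueMap_mul {u : List R.E} (x : PathAlgebra k R.Vertex) (v : List R.E) :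
    continueMap k u (x * (idem k R * letters k v)) = continueMap k u x * R.cls k v := by
  induction x using induction_ofPath with
  | @ofPath x y π =>
    rw [← mul_assoc]
    by_cases hy : y.2.val = 0
    · obtain ⟨q, rfl⟩ : ∃ q, y = stateVertex q := ⟨_, eq_stateVertex hy⟩
      rw [ofPath_mul_idem, ← ofPath_mul_stateIdem, mul_assoc, ofPath_mul_stateIdem]
      by_cases hq : Avoids R.F (q.1 ++ v)
      · obtain ⟨q', π', hπ', h⟩ := exists_path_eq (k := k) q v hq
        rw [h, ofPath_mul_of_eq]
        by_cases hx : EndsAt u x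
        · rw [continueMap_of_endsAt _ hx, continueMap_of_endsAt _ hx, label_comp, hπ',
            ← List.append_assoc]
          exact wordClass_append R.d R.one_le _ _ _
        · rw [continueMap_eq_zero _ fun h => absurd h hx,
            continueMap_eq_zero _ fun h => absurd h hx, zero_mul]
      · rw [stateIdem_mul_letters_eq_zero q v hq, mul_zero, map_zero]
        by_cases hx : EndsAt u x
        · rw [continueMap_of_endsAt _ hx]
          refine Eq.trans ?_ (wordClass_append R.d R.one_le _ _ _)
          -- The letters of `q` are the last ones of `u ++ label π`, so a forbidden factor of `q.1
          -- ++ v` is also one of `u ++ label π ++ v`.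
          obtain ⟨s, hs, hsq⟩ := not_avoids_iff.mp hq
          refine (wordClass_eq_zero R.d R.one_le ⟨s, hs, hsq.trans ?_⟩).symm
          have h1 : q.1 <:+ u ++ label π := by
            obtain ⟨t, ht⟩ := hx.suffix
            have h2 : q.1 = _ := state_eq_drop π
            rw [h2, ← ht, List.append_assoc]
            exact (List.drop_suffix _ _).trans (List.suffix_append _ _)
          obtain ⟨t, ht⟩ := h1
          exact ⟨t, [], by rw [← ht, List.append_nil, List.append_assoc]⟩
        · rw [continueMap_eq_zero _ fun h => absurd h hx, zero_mul]
    · rw [ofPath_mul_idem_of_ne π hy, zero_mul, map_zero, continueMap_eq_zero π fun _ => hy,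
        zero_mul]
  | zero => rw [zero_mul, map_zero, zero_mul]
  | add x y hx hy => rw [add_mul, map_add, hx, hy, map_add, add_mul]
  | smul c x hx => rw [smul_mul_assoc, map_smul, hx, map_smul, smul_mul_assoc]

theorem continueMap_mem_grading {u : List R.E} {j : ℕ} {x : PathAlgebra k R.Vertex}
    (hx : x ∈ PathAlgebra.grading k R.graph j) :
    continueMap k u x ∈ (R.alg k).grading (wordDeg R.d u + j) := by
  induction hx using Submodule.span_induction with
  | mem x hx =>
    obtain ⟨⟨x, y, π⟩, hπ, rfl⟩ := hx
    replace hπ : π.length = j := (pathDeg_graph π).symm.trans hπ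
    by_cases h : EndsAt u x ∧ y.2.val = 0
    · obtain ⟨q, rfl⟩ : ∃ q, y = stateVertex q := ⟨_, eq_stateVertex h.2⟩
      rw [continueMap_of_endsAt π h.1]
      have h1 := length_add_eq π
      rw [h.1.1, h.2, add_zero, zero_add] at h1
      rw [← hπ, h1, ← wordDeg_append]
      exact wordClass_mem_grading R.d R.one_le _ _
    · rw [continueMap_eq_zero π fun hx hy => h ⟨hx, hy⟩]
      exact Submodule.zero_mem _
  | zero => rw [map_zero]; exact Submodule.zero_mem _
  | add x y _ _ hx hy => rw [map_add]; exact Submodule.add_mem _ hx hy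
  | smul c x _ hx => rw [map_smul]; exact Submodule.smul_mem _ c hx

/-- The image of `u` ends only at the state where continuation begins. Multiplying it by a path from
that state to a state reads on along the label, and paths with other endpoints are killed by one of
the outer factors. -/
theorem map_continueMap (f : GrNUHom (R.alg k) (pathGradedAlg k R.graph))
    (hf : ∀ w, f (R.cls k w) = (idem k R * letters k w : PathAlgebra k R.Vertex))
    {u : List R.E} (hu : R.L ≤ u.length) (x : PathAlgebra k R.Vertex) :
    f (continueMap k u x) = (idem k R * letters k u * x * idem k R : PathAlgebra k R.Vertex) := by
  induction x using induction_ofPath with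
  | @ofPath x y π =>
    by_cases hx : EndsAt u x
    · by_cases hy : y.2.val = 0
      · obtain ⟨q, rfl⟩ : ∃ q, y = stateVertex q := ⟨_, eq_stateVertex hy⟩
        obtain ⟨p, rfl⟩ : ∃ p, x = stateVertex p := ⟨_, eq_stateVertex hx.1⟩
        rw [continueMap_of_endsAt π hx, hf, letters_append, mul_assoc (_ * _), ofPath_mul_idem,
          ofPath_eq_tail_mul π, tail_stateVertex, ← mul_assoc (_ * _),
          idem_mul_letters_mul_stateIdem hu (q := p) hx.2]
        exact (mul_assoc _ _ _).symm
      · rw [continueMap_eq_zero π fun _ => hy, mul_assoc (_ * _), ofPath_mul_idem_of_ne π hy,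
          mul_zero]
        exact map_zero f.toHom
    · rw [continueMap_eq_zero π fun h => absurd h hx,
        idem_mul_letters_mul_ofPath hu π fun h h' => hx ⟨h, h'⟩, zero_mul]
      exact map_zero f.toHom
  | zero =>
    rw [map_zero, mul_zero, zero_mul]
    exact map_zero f.toHom
  | add x y hx hy =>
    rw [map_add, mul_add, add_mul, ← hx, ← hy]
    exact map_add f.toHom _ _
  | smul c x hx =>
    rw [map_smul, mul_smul_comm, smul_mul_assoc, ← hx]
    exact map_smul f.toHom _ _

/-- The conditions on the lift are linear in `a`, so it suffices to treat words: an allowed word `u`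
is lifted by `continueMap k u`, and a forbidden one, whose class is zero, by the zero map. -/
theorem forall_exists_lift (f : GrNUHom (R.alg k) (pathGradedAlg k R.graph))
    (hf : ∀ w, f (R.cls k w) = (idem k R * letters k w : PathAlgebra k R.Vertex))
    {n : ℕ} (hn : R.D * R.L ≤ n) {a : (R.alg k).carrier} (ha : a ∈ (R.alg k).grading n) :
    ∃ L : (pathGradedAlg k R.graph).carrier →ₗ[k] (R.alg k).carrier, L 1 = a ∧
      (∀ b a', L (b * f a') = L b * a') ∧
      (∀ j, ∀ b ∈ (pathGradedAlg k R.graph).grading j, L b ∈ (R.alg k).grading (n + j)) ∧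
      ∀ b, f (L b) = f a * b * f 1 := by
  have hf1 : f 1 = (idem k R : PathAlgebra k R.Vertex) := by
    rw [← wordClass_nil, hf, letters_nil, mul_one]
  rw [grading_wordAlg] at ha
  induction ha using Submodule.span_induction with
  | mem a ha =>
    obtain ⟨u, hu, rfl⟩ := ha
    replace hu : wordDeg R.d u = n := hu
    by_cases hau : Avoids R.F u
    -- Each letter weighs at most `D`, so degree at least `D * L` forces at least `L` letters.
    · have hL : R.L ≤ u.length := by
        have := R.wordDeg_le u
        exact Nat.le_of_mul_le_mul_left (by omega) R.one_le_bound
      obtain ⟨L, h1, h2, h3, h4⟩ : ∃ L : (pathGradedAlg k R.graph).carrier →ₗ[k] (R.alg k).carrier,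
          L 1 = R.cls k u ∧ (∀ b v, L (b * f (R.cls k v)) = L b * R.cls k v) ∧
          (∀ j, ∀ b ∈ (pathGradedAlg k R.graph).grading j,
            L b ∈ (R.alg k).grading (wordDeg R.d u + j)) ∧
          ∀ b, f (L b) = f (R.cls k u) * b * f 1 := by
        refine ⟨continueMap k u, continueMap_one hL hau, fun b v => ?_,
          fun j b hb => continueMap_mem_grading hb, fun b => ?_⟩
        · rw [hf]
          exact continueMap_mul b v
        · rw [hf, hf1]
          exact map_continueMap f hf hL b
      refine ⟨L, h1, fun b a => ?_, hu ▸ h3, h4⟩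
      have h : a ∈ Submodule.span k (Set.range (R.cls k)) := by
        rw [span_wordClass]; trivial
      induction h using Submodule.span_induction with
      | mem a ha =>
        obtain ⟨v, rfl⟩ := ha
        exact h2 b v
      | zero => rw [map_zero, mul_zero, map_zero, mul_zero]
      | add x y _ _ hx hy => rw [map_add, mul_add, map_add, hx, hy, mul_add]
      | smul c x _ hx => rw [map_smul, mul_smul_comm, map_smul, hx, mul_smul_comm]
    · have h0 : R.cls k u = 0 := wordClass_eq_zero R.d R.one_le (not_avoids_iff.mp hau)
      refine ⟨0, h0.symm, fun _ _ => (zero_mul _).symm, fun _ _ _ => Submodule.zero_mem _,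
        fun b => ?_⟩
      rw [show wordClass k R.d R.one_le R.F u = 0 from h0, LinearMap.zero_apply,
        map_zero, zero_mul, zero_mul]
  | zero =>
    refine ⟨0, rfl, fun _ _ => (zero_mul _).symm, fun _ _ _ => Submodule.zero_mem _, fun b => ?_⟩
    rw [LinearMap.zero_apply, map_zero, zero_mul, zero_mul]
  | add a a' _ _ ha ha' =>
    obtain ⟨L, h1, h2, h3, h4⟩ := ha
    obtain ⟨L', h1', h2', h3', h4'⟩ := ha'
    refine ⟨L + L', ?_, fun b c => ?_, fun j b hb => ?_, fun b => ?_⟩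
    · rw [LinearMap.add_apply, h1, h1']
    · rw [LinearMap.add_apply, LinearMap.add_apply, h2, h2', add_mul]
    · exact Submodule.add_mem _ (h3 j b hb) (h3' j b hb)
    · rw [LinearMap.add_apply, map_add, h4, h4', map_add, add_mul, add_mul]
  | smul c a _ ha =>
    obtain ⟨L, h1, h2, h3, h4⟩ := ha
    refine ⟨c • L, ?_, fun b a => ?_, fun j b hb => ?_, fun b => ?_⟩
    · rw [LinearMap.smul_apply, h1]
    · rw [LinearMap.smul_apply, LinearMap.smul_apply, h2, smul_mul_assoc]
    · exact Submodule.smul_mem _ c (h3 j b hb)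
    · rw [LinearMap.smul_apply, map_smul, h4, map_smul, smul_mul_assoc, smul_mul_assoc]

variable (k R)

/-- A long path completes a letter in progress, reads a word, and ends inside one further letter.
The left factors are the completions, one per vertex and hence finitely many. In the bound, up to
`D` is lost in each of three places: the initial completion, the final letter, and the overshoot
when the word is cut at degree `n`. -/
theorem exists_generators (f : GrNUHom (R.alg k) (pathGradedAlg k R.graph))
    (hf : ∀ w, f (R.cls k w) = (idem k R * letters k w : PathAlgebra k R.Vertex)) (n m j : ℕ)
    (hj : n + m + 3 * R.D < j) {b : (pathGradedAlg k R.graph).carrier}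
    (hb : b ∈ (pathGradedAlg k R.graph).grading j) :
    b ∈ Submodule.span k {x : (pathGradedAlg k R.graph).carrier |
      ∃ q : (pathGradedAlg k R.graph).carrier, (∃ y : R.Vertex, tail k y = q) ∧ ∃ i ≥ n,
      ∃ a ∈ (R.alg k).grading i, ∃ i' ≥ m, ∃ a' ∈ (R.alg k).grading i',
      ∃ c, x = q * f a * f a' * c} := by
  refine Submodule.span_le.mpr ?_ hb
  rintro _ ⟨⟨x, y, π⟩, hπ, rfl⟩
  replace hπ : π.length = j := (pathDeg_graph π).symm.trans hπ
  have hx : x.2.val < R.D + 1 := x.2.isLt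
  rcases ofPath_factor (k := k) π with ⟨v, c, h1, h2⟩ | h2
  · obtain ⟨v₁, v₂, rfl, h3, h4⟩ := exists_split_word R.d R.le_bound v n (by omega)
    rw [wordDeg_append] at h2
    refine Submodule.subset_span ⟨_, ⟨x, rfl⟩, _, h3, _, wordClass_mem_grading R.d R.one_le _ v₁,
      wordDeg R.d v₂, by omega, _, wordClass_mem_grading R.d R.one_le _ v₂, c, ?_⟩
    have h5 : f (R.cls k v₁) * f (R.cls k v₂) = _ :=
      (map_mul f.toHom _ _).symm.trans ((congrArg f (wordClass_append _ _ _ _ _).symm).trans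
        (hf (v₁ ++ v₂)))
    have h6 : tail k x * letters k (v₁ ++ v₂) = tail k x * (idem k R * letters k (v₁ ++ v₂)) := by
      rw [← mul_assoc, tail_mul_idem]
    exact h1.trans (congrArg (· * c) (h6.trans
      ((congrArg (tail k x * ·) h5.symm).trans (mul_assoc _ _ _).symm)))
  · omega

theorem qGrEquiv : QGrEquiv (pathGradedAlg k R.graph) (R.alg k) := by
  classical
  obtain ⟨f, hf⟩ := R.exists_hom k
  refine GrNUHom.IsTailEquiv.qGrEquiv (f := f) (m := R.D * R.L)
    ⟨locallyFinite_wordAlg _ _ _, PathAlgebra.finite_grading R.graph,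
      fun n hn a ha => forall_exists_lift f hf hn ha,
      (Finset.univ : Finset R.Vertex).image (tail k),
      fun n => ⟨n + R.D * R.L + 3 * R.D + 1, fun j hj b hb => ?_⟩⟩
  refine Submodule.span_mono ?_ (R.exists_generators k f hf n (R.D * R.L) j (by omega) hb)
  rintro x ⟨_, ⟨v, rfl⟩, h⟩
  exact ⟨_, Finset.mem_image_of_mem _ (Finset.mem_univ v), h⟩

end WordData

/-! ### Combination of the equivalences -/

/-- Every monomial algebra has the same quotient category as a path algebra all of whose arrows
have degree one. -/
theorem exists_qGrEquiv_pathGradedAlg {A : GradedAlg k} {Q : WeightedQuiver}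
    {S : Set (PathOf Q.V)} (hS : S.Finite) (g : PathAlgebra k Q.V →ₐ[k] A.carrier)
    (hgr : ∀ n, (PathAlgebra.grading k Q n).map g.toLinearMap = A.grading n)
    (hg : ∀ x, g x = 0 ↔ x ∈ monomialIdeal k Q S) :
    ∃ Q' : WeightedQuiver, (∀ (v w : Q'.V) (a : v ⟶ w), Q'.deg a = 1) ∧
      QGrEquiv A (pathGradedAlg k Q') := by
  obtain ⟨F, hF, h⟩ := exists_qGrEquiv_wordAlg hS g hgr hg
  obtain ⟨L, hL⟩ := (hF.image List.length).bddAbove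
  obtain ⟨D, hD⟩ := (Set.finite_range (arrowDeg Q)).bddAbove
  let R : WordData :=
    { E := ArrowOf Q.V
      d := arrowDeg Q
      one_le := fun e => Q.one_le_deg e.2.2
      F := F
      L := L
      length_le := fun s hs => (hL ⟨s, hs, rfl⟩).trans (Nat.le_succ _)
      -- The successor keeps the bound positive even for a quiver without arrows.
      D := D + 1
      le_bound := fun e => (hD ⟨e, rfl⟩).trans (Nat.le_succ _)
      one_le_bound := Nat.succ_pos _ }
  exact ⟨R.graph, fun _ _ _ => rfl, h.trans (R.qGrEquiv k).symm⟩

theorem mem_monomialIdeal_empty {Q : WeightedQuiver} {x : PathAlgebra k Q.V} :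
    x ∈ monomialIdeal k Q ∅ ↔ x = 0 := by
  rw [monomialIdeal, Set.image_empty]
  constructor
  · intro h
    have h1 : TwoSidedIdeal.span (∅ : Set (PathAlgebra k Q.V)) ≤ ⊥ :=
      TwoSidedIdeal.span_le.mpr (Set.empty_subset _)
    exact (TwoSidedIdeal.mem_bot _).mp (h1 h)
  · rintro rfl
    exact TwoSidedIdeal.zero_mem _

/-- Every algebra in one of the five classes is a quotient of a path algebra by a monomial
ideal. -/
theorem AlgClass.exists_presentation {C : AlgClass} {A : GradedAlg k} (hA : C.Mem A) :
    ∃ (Q : WeightedQuiver) (S : Set (PathOf Q.V)) (g : PathAlgebra k Q.V →ₐ[k] A.carrier),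
      S.Finite ∧ (∀ n, (PathAlgebra.grading k Q n).map g.toLinearMap = A.grading n) ∧
      ∀ x, g x = 0 ↔ x ∈ monomialIdeal k Q S := by
  have hpath : ∀ Q : WeightedQuiver, A.IsPathAlgebraOf Q →
      ∃ (Q : WeightedQuiver) (S : Set (PathOf Q.V)) (g : PathAlgebra k Q.V →ₐ[k] A.carrier),
        S.Finite ∧ (∀ n, (PathAlgebra.grading k Q n).map g.toLinearMap = A.grading n) ∧
        ∀ x, g x = 0 ↔ x ∈ monomialIdeal k Q S := by
    rintro Q ⟨e, he⟩
    refine ⟨Q, ∅, e.toAlgHom, Set.finite_empty, he, fun x => ?_⟩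
    rw [mem_monomialIdeal_empty]
    exact map_eq_zero_iff e e.injective
  have hmon : ∀ (Q : WeightedQuiver) (S : Set (PathOf Q.V)), S.Finite → A.IsMonomialAlgebraOf Q S →
      ∃ (Q : WeightedQuiver) (S : Set (PathOf Q.V)) (g : PathAlgebra k Q.V →ₐ[k] A.carrier),
        S.Finite ∧ (∀ n, (PathAlgebra.grading k Q n).map g.toLinearMap = A.grading n) ∧
        ∀ x, g x = 0 ↔ x ∈ monomialIdeal k Q S := by
    rintro Q S hS ⟨e, he⟩
    refine ⟨Q, S, e.toAlgHom.comp (MonomialAlgebra.mk k Q S), hS, fun n => ?_, fun x => ?_⟩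
    · rw [← he n]
      exact Submodule.map_comp (MonomialAlgebra.mk k Q S).toLinearMap e.toLinearMap _
    · exact (map_eq_zero_iff e e.injective).trans MonomialAlgebra.mk_eq_zero_iff
  cases C with
  | PA1 => obtain ⟨Q, -, h⟩ := hA; exact hpath Q h
  | WPA => obtain ⟨Q, h⟩ := hA; exact hpath Q h
  | MA => obtain ⟨Q, S, hS, h⟩ := hA; exact hmon Q S hS h
  | CMA => obtain ⟨Q, S, -, hS, h⟩ := hA; exact hmon Q S hS h
  | CMA1 => obtain ⟨⟨Q, S, -, hS, h⟩, -⟩ := hA; exact hmon Q S hS h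

/-- A path algebra all of whose arrows have degree one has the same quotient category as a
connected monomial algebra that is generated in degree one. -/
theorem exists_qGrEquiv_connected (Q : WeightedQuiver)
    (hQ : ∀ (v w : Q.V) (a : v ⟶ w), Q.deg a = 1) :
    ∃ A : GradedAlg k, AlgClass.CMA1.Mem A ∧ QGrEquiv (pathGradedAlg k Q) A := by
  obtain ⟨F, hF, h⟩ := exists_qGrEquiv_wordAlg (A := pathGradedAlg k Q) (S := ∅) Set.finite_empty
    (AlgHom.id k (PathAlgebra k Q.V)) (fun n => Submodule.map_id _)
    (fun x => mem_monomialIdeal_empty.symm)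
  refine ⟨_, ⟨⟨_, _, ?_, hF.image _, isMonomialAlgebraOf_wordAlg _ _⟩,
    adjoin_wordAlg _ _ fun e => hQ _ _ e.2.2⟩, h⟩
  exact Nat.card_unique

/-- Two target algebras serve all five classes: the path algebra in degree 1 for `PA1` and `WPA`,
and the connected algebra generated in degree 1 for the three monomial classes. -/
theorem AlgClass.exists_qGrEquiv (C C' : AlgClass) {A : GradedAlg k} (hA : C.Mem A) :
    ∃ A' : GradedAlg k, C'.Mem A' ∧ QGrEquiv A A' := by
  obtain ⟨Q, S, g, hS, hgr, hg⟩ := exists_presentation hA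
  obtain ⟨Q', hQ', h⟩ := exists_qGrEquiv_pathGradedAlg hS g hgr hg
  obtain ⟨A', hA', h'⟩ := exists_qGrEquiv_connected (k := k) Q' hQ'
  have hp := isPathAlgebraOf_pathGradedAlg (k := k) Q'
  cases C' with
  | PA1 => exact ⟨_, ⟨Q', hQ', hp⟩, h⟩
  | WPA => exact ⟨_, ⟨Q', hp⟩, h⟩
  | MA =>
    obtain ⟨⟨Q, S, -, hm⟩, -⟩ := hA'
    exact ⟨A', ⟨Q, S, hm⟩, h.trans h'⟩
  | CMA => exact ⟨A', hA'.1, h.trans h'⟩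
  | CMA1 => exact ⟨A', hA', h.trans h'⟩

end QuiverAlgebra

end

theorem theorem1p1 {k : Type u} [Field k] (C C' : QuiverAlgebra.AlgClass)
    (A : QuiverAlgebra.GradedAlg k) (hA : C.Mem A) :
    ∃ A' : QuiverAlgebra.GradedAlg k, C'.Mem A' ∧
      ∃ F : QuiverAlgebra.QGr A ≌ QuiverAlgebra.QGr A',
        Nonempty (QuiverAlgebra.QGr.shift A ⋙ F.functor ≅
          F.functor ⋙ QuiverAlgebra.QGr.shift A') :=
  C.exists_qGrEquiv C' hA
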